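/- Conventions. For a model category $\mathcal{N}$, $\mathrm{map}_{\mathcal{N}}(-,-)$ denotes the homotopy function complex (for fibrant $X$ it is computed as $\mathcal{N}(A^{\bullet},X)$ with $A^{\bullet}$ a cosimplicial resolution of $A$, i.e. a Reedy cofibrant cosimplicial object with a levelwise weak equivalence to the constant object $A$). For a class of maps $\mathcal{C}$ in $\mathcal{N}$: - an object $X$ is *$\mathcal{C}$-local* if it is fibrant and $\mathrm{map}_{\mathcal{N}}(B,X)\to\mathrm{map}_{\mathcal{N}}(A,X)$ is a weak equivalence of simplicial sets for all $f\colon A\to B$ in $\mathcal{C}$; - a map $f\colon A\to B$ is a *$\mathcal{C}$-local equivalence* if $\mathrm{map}_{\mathcal{N}}(B,X)\to\mathrm{map}_{\mathcal{N}}(A,X)$ is a weak equivalence of simplicial sets for all $\mathcal{C}$-local $X$; - the *left Bousfield localization* $L_{\mathcal{C}}\mathcal{N}$ *exists* if the category $\mathcal{N}$, with the cofibrations of $\mathcal{N}$, with the $\mathcal{C}$-local equivalences as weak equivalences, and with the maps having the right lifting property with respect to all cofibrations that are $\mathcal{C}$-local equivalences as fibrations, is a model category whose fibrant objects are precisely the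 $\mathcal{C}$-local objects; $L_{\mathcal{C}}\mathcal{N}$ denotes this model category. For a left adjoint functor $F\colon\mathcal{N}'\to\mathcal{N}$ into a model category, $\mathcal{N}'$ *admits the left-induced model structure* via $F$ if it admits a model structure in which a map $f$ is a weak equivalence (resp. cofibration) if and only if $Ff$ is one in $\mathcal{N}$. Theorem. Let $\mathcal{M}$ be a model category and $\mathcal{C}$ a class of cofibrations between cofibrant objects of $\mathcal{M}$ such that $L_{\mathcal{C}}\mathcal{M}$ exists. Let $K$ be a comonad on $\mathcal{M}$ such that the category $\mathrm{Coalg}(K;\mathcal{M})$ of $K$-coalgebras admits the left-induced model structure via the forgetful functor $U$ to $\mathcal{M}$. Let $\mathcal{C}'$ be the class of maps $f\colon A\to B$ in $\mathrm{Coalg}(K;\mathcal{M})$ such that $$\mathrm{map}_{\mathrm{Coalg}(K;\mathcal{M})}(B,KX)\longrightarrow\mathrm{map}_{\mathrm{Coalg}(K;\mathcal{M})}(A,KX)$$ is a weak equivalence of simplicial sets for every $\mathcal{C}$-local object $X$ of $\mathcal{M}$, where $KX$ is the cofree $K$-coalgebra on $X$. Then the following are equivalent: 1. $\mathrm{Coalg}(K;L_{\mathcal{C}}\mathcal{M})$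 (the same category of coalgebras) admits the left-induced model structure via the forgetful functor $U$ to $L_{\mathcal{C}}\mathcal{M}$; 2. the left Bousfield localization $L_{\mathcal{C}'}\mathrm{Coalg}(K;\mathcal{M})$ exists. Furthermore, if either statement holds, then $\mathrm{Coalg}(K;L_{\mathcal{C}}\mathcal{M})=L_{\mathcal{C}'}\mathrm{Coalg}(K;\mathcal{M})$ as model categories. -/

import Mathlib

open CategoryTheory CategoryTheory.Limits HomotopicalAlgebra
open scoped Simplicial

universe v u v' u'

noncomputable section

namespace SimplicialSets

/-- The set of simplicial homotopy classes of maps `X ⟶ Z`: the quotient of the set of maps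
by the equivalence relation generated by simplicial homotopy (simplicial homotopy is already an
equivalence relation when `Z` is a Kan complex). -/
def HomotopyClasses (X Z : SSet.{v}) : Type v :=
  Quot (fun g h : X ⟶ Z => Nonempty (SSet.Homotopy g h))

/-- Precomposition with `f : X ⟶ Y` on simplicial homotopy classes of maps. -/
def HomotopyClasses.precomp {X Y : SSet.{v}} (f : X ⟶ Y) (Z : SSet.{v}) :
    HomotopyClasses Y Z → HomotopyClasses X Z :=
  Quot.map (fun g => f ≫ g) (by
    rintro g h ⟨H⟩
    exact ⟨SSet.RelativeMorphism.Homotopy.precomp H (SSet.RelativeMorphism.botEquiv.symm f) (by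
      ext _ x
      exact x.2.elim)⟩)

/-- A map `f : X ⟶ Y` of simplicial sets is a weak (homotopy) equivalence if for every Kan complex
`Z` precomposition with `f` is a bijection `[Y, Z] → [X, Z]` on simplicial homotopy classes. -/
def IsWeakEquivalence {X Y : SSet.{v}} (f : X ⟶ Y) : Prop :=
  ∀ (Z : SSet.{v}) [SSet.KanComplex Z], Function.Bijective (HomotopyClasses.precomp f Z)

end SimplicialSets

namespace Reedy

/-- Objects of the latching category of `SimplexCategory` at `⦋n⦌`: the injective maps
`⦋m⦌ ⟶ ⦋n⦌` that are not the identity, i.e. those with `m < n`. -/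
def LatchingIndex (n : ℕ) : Type :=
  Σ m : Fin n, {i : (⦋(m : ℕ)⦌ : SimplexCategory) ⟶ ⦋n⦌ // Mono i}

/-- The object of the over category of `⦋n⦌` given by an index. -/
def LatchingIndex.toOver {n : ℕ} (x : LatchingIndex n) : Over (⦋n⦌ : SimplexCategory) :=
  Over.mk x.2.1

/-- The latching category at `⦋n⦌`, as a full subcategory of the over category of `⦋n⦌`. (A map over
`⦋n⦌` between injective maps is automatically injective.) -/
abbrev LatchingCategory (n : ℕ) : Type := InducedCategory _ (LatchingIndex.toOver (n := n))

instance (n : ℕ) : Finite (LatchingCategory n) :=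
  inferInstanceAs (Finite (Σ m : Fin n, {i : (⦋(m : ℕ)⦌ : SimplexCategory) ⟶ ⦋n⦌ // Mono i}))

instance (n : ℕ) (x y : LatchingCategory n) : Finite (x ⟶ y) :=
  Finite.of_injective
    (fun g => (g.hom.left : (⦋(x.1 : ℕ)⦌ : SimplexCategory) ⟶ ⦋(y.1 : ℕ)⦌))
    (fun _ _ e => InducedCategory.hom_ext (Over.OverMorphism.ext e))

instance (n : ℕ) : FinCategory (LatchingCategory n) where
  fintypeObj := Fintype.ofFinite _
  fintypeHom _ _ := Fintype.ofFinite _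

variable {M : Type u} [Category.{v} M]

/-- The diagram `(⦋m⦌ ↪ ⦋n⦌) ↦ A^m` on the latching category at `⦋n⦌`. -/
def latchingDiagram (A : CosimplicialObject M) (n : ℕ) : LatchingCategory n ⥤ M :=
  inducedFunctor _ ⋙ Over.forget _ ⋙ A

/-- The canonical cocone with point `A^n`. -/
def latchingCocone (A : CosimplicialObject M) (n : ℕ) : Cocone (latchingDiagram A n) where
  pt := A.obj ⦋n⦌
  ι :=
    { app := fun x => A.map x.2.1
      naturality := fun x y g => by
        have h : g.hom.left ≫ y.2.1 = x.2.1 := Over.w g.hom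
        simp only [latchingDiagram, Functor.comp_map, Functor.const_obj_obj,
          Functor.const_obj_map, Category.comp_id]
        rw [← h]
        exact (A.map_comp _ _).symm }

/-- The latching map `L_n A ⟶ A^n` of a cosimplicial object. -/
def latchingMap [HasFiniteColimits M] (A : CosimplicialObject M) (n : ℕ) :
    colimit (latchingDiagram A n) ⟶ A.obj ⦋n⦌ :=
  colimit.desc (latchingDiagram A n) (latchingCocone A n)

end Reedy

/-! A category may carry several model structures, so that model structures are passed explicitly
below. A `ModelCategory` in Mathlib is a closed model category in the sense of Quillen: a category
with finite limits and colimits and three classes of maps satisfying CM2 - CM5. It is determined by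
these three classes. -/

namespace ModelStructure

section

variable {M : Type u} [Category.{v} M] (S : ModelCategory M)

/-- The weak equivalences of the model structure `S`. -/
def W : MorphismProperty M := letI := S; weakEquivalences M

/-- The cofibrations of the model structure `S`. -/
def Cof : MorphismProperty M := letI := S; cofibrations M

/-- The fibrations of the model structure `S`. -/
def Fib : MorphismProperty M := letI := S; fibrations M

/-- The fibrant objects of the model structure `S`. -/
def Fibrant (X : M) : Prop := letI := S; IsFibrant X

/-- The cofibrant objects of the model structure `S`. -/
def Cofibrant (X : M) : Prop := letI := S; IsCofibrant X

/-- A cosimplicial object is Reedy cofibrant if all its latching maps are cofibrations. -/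
def ReedyCofibrant (A : CosimplicialObject M) : Prop :=
  letI := S; ∀ n : ℕ, Cof S (Reedy.latchingMap A n)

/-- A cosimplicial resolution of `A`: a Reedy cofibrant cosimplicial object with a levelwise
weak equivalence to the constant cosimplicial object at `A`. -/
structure CosimplicialResolution (A : M) where
  /-- the cosimplicial object -/
  obj : CosimplicialObject M
  /-- the augmentation -/
  aug : obj ⟶ (CosimplicialObject.const M).obj A
  reedyCofibrant : ReedyCofibrant S obj
  weakEquivalence : ∀ n : SimplexCategory, W S (aug.app n)

/-- A cosimplicial resolution of a map `f : A ⟶ B`: a map over `f` from a cosimplicial resolution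
of `A` to a cosimplicial resolution of `B`. -/
structure MapResolution {A B : M} (f : A ⟶ B) where
  /-- the resolution of the source -/
  source : CosimplicialResolution S A
  /-- the resolution of the target -/
  target : CosimplicialResolution S B
  /-- the map of cosimplicial objects -/
  map : source.obj ⟶ target.obj
  comm : map ≫ target.aug = source.aug ≫ (CosimplicialObject.const M).map f

end

section

variable {M : Type u} [Category.{v} M]

/-- The simplicial set `M(A^•, X)` with `n`-simplices the maps `A^n ⟶ X`. When `A^•` is a
cosimplicial resolution of `A` and `X` is fibrant, this is a homotopy function complex
`map(A, X)`. -/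
def mappingComplex (A : CosimplicialObject M) (X : M) : SSet.{v} :=
  A.op ⋙ yoneda.obj X

/-- The map `M(B^•, X) ⟶ M(A^•, X)` induced by a map `A^• ⟶ B^•`. -/
def mappingComplexMap {A B : CosimplicialObject M} (g : A ⟶ B) (X : M) :
    mappingComplex B X ⟶ mappingComplex A X :=
  Functor.whiskerRight (NatTrans.op g) (yoneda.obj X)

variable (S : ModelCategory M)

/-- For a fibrant object `X` and a map `f : A ⟶ B`, the assertion that the induced map of homotopy
function complexes `map(B, X) ⟶ map(A, X)` is a weak equivalence of simplicial sets. The complexes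
are computed by a cosimplicial resolution of `f`; the assertion does not depend on its choice. -/
def MapIsWeakEquivalence {A B : M} (f : A ⟶ B) (X : M) : Prop :=
  ∃ r : MapResolution S f, SimplicialSets.IsWeakEquivalence (mappingComplexMap r.map X)

/-- The `C`-local objects. -/
def IsLocalObject (C : MorphismProperty M) (X : M) : Prop :=
  Fibrant S X ∧ ∀ ⦃A B : M⦄ (f : A ⟶ B), C f → MapIsWeakEquivalence S f X

/-- The class of `C`-local equivalences. -/
def localEquivalences (C : MorphismProperty M) : MorphismProperty M :=
  fun _ _ f => ∀ X : M, IsLocalObject S C X → MapIsWeakEquivalence S f X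

/-- The model structure `L` on `M` is the left Bousfield localization of the model structure `S`
with respect to the class of maps `C`. -/
structure IsLeftBousfieldLocalization (C : MorphismProperty M) (L : ModelCategory M) : Prop where
  cofibrations_eq : Cof L = Cof S
  weakEquivalences_eq : W L = localEquivalences S C
  fibrations_eq : Fib L = (Cof S ⊓ localEquivalences S C).rlp
  fibrant_iff : ∀ X : M, Fibrant L X ↔ IsLocalObject S C X

/-- The model structure `T` on `N` is left-induced from the model structure `S` on `M` via the
functor `F : N ⥤ M` (a left adjoint in practice). -/
structure IsLeftInduced {N : Type u'} [Category.{v'} N] (F : N ⥤ M) (T : ModelCategory N) :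
    Prop where
  weakEquivalences_eq : W T = (W S).inverseImage F
  cofibrations_eq : Cof T = (Cof S).inverseImage F

/-- For a comonad `K` on `M` and a model structure `T` on the category of `K`-coalgebras, the class
of the maps of coalgebras `f : A ⟶ B` such that `map(B, KX) ⟶ map(A, KX)` is a weak equivalence
for all `C`-local objects `X`, where `KX` is the cofree coalgebra on `X`. -/
def coalgebraClass (C : MorphismProperty M) (K : Comonad M) (T : ModelCategory K.Coalgebra) :
    MorphismProperty K.Coalgebra :=
  fun _ _ f => ∀ X : M, IsLocalObject S C X → MapIsWeakEquivalence T f (K.cofree.obj X)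

end

end ModelStructure

end

open ModelStructure

/-!
Let `U ⊣ K` be the adjunction between the forgetful functor from `K`-coalgebras and the cofree
coalgebra functor.

*The class `C'`.* Since `T` is left-induced, `U` preserves cosimplicial resolutions, and the
adjunction identifies `map(A, KX)` with `map(U A, X)` for fibrant `X`. So `C'` is the inverse image
under `U` of the class of `C`-local equivalences, which are the weak equivalences of `L_C M`
(`coalgebraClass_eq`). Moreover `KX` is `C'`-local when `X` is `C`-local, so that the `C'`-local
equivalences are the members of `C'` (`localEquivalences_coalgebraClass`). Hence the left-induced
structure and the left Bousfield localization prescribe the same cofibrations and the same weak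
equivalences, which determine a model structure (`modelCategory_ext`). A localization is therefore
left-induced at once.

*Fibrant objects.* For the converse, let `I` be a model structure with the cofibrations of `T` whose
weak equivalences are the maps in `C'`; its fibrant objects have to be the `C'`-local objects
(`isLeftBousfieldLocalization_of_eq`). If `X` is fibrant for `I` and `f` is in `C'`, a resolution of
`f` for `T` that is a Reedy cofibration is a Reedy trivial cofibration for `I`, so it induces a
trivial Kan fibration on mapping complexes to `X` (`ReedyCofibration.isWeakEquivalence`). If `X` is
`C'`-local, let `i : X ⟶ Y` be a fibrant replacement for `I` that is a cofibration. As `X` and `Y`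
are `C'`-local and `i` is a `C'`-local equivalence, `i` becomes invertible in the homotopy category
of `T`, hence is a weak equivalence of `T` (`weakEquivalence_of_mapIsWeakEquivalence`). So `i` is a
trivial cofibration of `T` with fibrant source, and `X` is a retract of `Y`.

*Resolutions.* `MapIsWeakEquivalence` refers to some resolution of a map, and the argument rests on
its independence of the choice (`isWeakEquivalence_mappingComplexMap_iff`) and on the existence of
resolutions that are Reedy cofibrations (`exists_mapResolution`). Both follow from the factorization
of maps of cosimplicial objects as a Reedy cofibration followed by a levelwise trivial fibration
(`exists_reedy_factorization`). It is built without matching objects: the degree `n` of a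
cosimplicial object `Y` is replaced by `X` in a pullback along
`X^{Δ[n]} ⟶ (Y^n)^{Δ[n]} × X^{∂Δ[n]}` (`attach`), and the factorization is the limit over `n`.
Lifting properties of relative latching maps are translated into lifting properties of maps of
mapping complexes against boundary inclusions (`hasLiftingProperty_boundary_leibnizHom_iff`), which
makes the calculus of Reedy cofibrations formal.
-/

/-! ### Weak equivalences of simplicial sets -/

namespace SimplicialSets

namespace HomotopyClasses

/-- The homotopy class of a map. -/
def mk {X Z : SSet.{v}} (g : X ⟶ Z) : HomotopyClasses X Z := Quot.mk _ g

lemma mk_surjective {X Z : SSet.{v}} (x : HomotopyClasses X Z) : ∃ g : X ⟶ Z, mk g = x :=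
  Quot.exists_rep x

lemma sound {X Z : SSet.{v}} {g h : X ⟶ Z} (H : SSet.Homotopy g h) : mk g = mk h :=
  Quot.sound ⟨H⟩

lemma precomp_mk {X Y : SSet.{v}} (f : X ⟶ Y) {Z : SSet.{v}} (g : Y ⟶ Z) :
    precomp f Z (mk g) = mk (f ≫ g) := rfl

lemma precomp_id (X Z : SSet.{v}) : precomp (𝟙 X) Z = id := by
  funext x
  obtain ⟨h, rfl⟩ := mk_surjective x
  rw [precomp_mk, Category.id_comp, id]

lemma precomp_comp {X Y Y' : SSet.{v}} (f : X ⟶ Y) (g : Y ⟶ Y') (Z : SSet.{v}) :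
    precomp (f ≫ g) Z = precomp f Z ∘ precomp g Z := by
  funext x
  obtain ⟨h, rfl⟩ := mk_surjective x
  rw [Function.comp_apply, precomp_mk, precomp_mk, precomp_mk, Category.assoc]

end HomotopyClasses

namespace IsWeakEquivalence

open scoped MonoidalCategory

variable {X Y Z : SSet.{v}}

lemma comp_iff_left {f : X ⟶ Y} (g : Y ⟶ Z) (hf : IsWeakEquivalence f) :
    IsWeakEquivalence (f ≫ g) ↔ IsWeakEquivalence g := by
  refine forall_congr' fun T ↦ forall_congr' fun _ ↦ ?_
  rw [HomotopyClasses.precomp_comp, Function.Bijective.of_comp_iff' (hf T)]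

lemma comp_iff_right (f : X ⟶ Y) {g : Y ⟶ Z} (hg : IsWeakEquivalence g) :
    IsWeakEquivalence (f ≫ g) ↔ IsWeakEquivalence f := by
  refine forall_congr' fun T ↦ forall_congr' fun _ ↦ ?_
  rw [HomotopyClasses.precomp_comp, Function.Bijective.of_comp_iff _ (hg T)]

lemma of_isIso (f : X ⟶ Y) [IsIso f] : IsWeakEquivalence f := by
  intro Z _
  refine Function.bijective_iff_has_inverse.mpr
    ⟨HomotopyClasses.precomp (inv f) Z, fun x ↦ ?_, fun x ↦ ?_⟩
  · rw [← Function.comp_apply (f := HomotopyClasses.precomp _ _), ← HomotopyClasses.precomp_comp,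
      IsIso.inv_hom_id, HomotopyClasses.precomp_id, id]
  · rw [← Function.comp_apply (f := HomotopyClasses.precomp _ _), ← HomotopyClasses.precomp_comp,
      IsIso.hom_inv_id, HomotopyClasses.precomp_id, id]

lemma of_square {X' Y' : SSet.{v}} {f : X ⟶ Y} {g : X' ⟶ Y'} {l : X ⟶ X'} {r : Y ⟶ Y'}
    (sq : f ≫ r = l ≫ g) (hl : IsWeakEquivalence l) (hr : IsWeakEquivalence r) :
    IsWeakEquivalence f ↔ IsWeakEquivalence g := by
  rw [← comp_iff_right f hr, sq, comp_iff_left g hl]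

/-- The two ends of a cylinder are disjoint. -/
lemma ι₀_app_ne_ι₁_app {n : SimplexCategoryᵒᵖ} (x y : X.obj n) :
    (SSet.ι₀ (X := X)).app n x ≠ (SSet.ι₁ (X := X)).app n y := by
  induction n using Opposite.rec with | _ n
  induction n using SimplexCategory.rec with | _ n
  intro h
  have h' := DFunLike.congr_fun (congr_arg Prod.snd h) (0 : Fin (n + 1))
  simp at h'

/-- The subcomplex `X × ∂Δ¹` of the cylinder `X × Δ¹`. -/
noncomputable def cylinderEnds (X : SSet.{v}) : (X ⊗ Δ[1] : SSet.{v}).Subcomplex :=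
  SSet.Subcomplex.range SSet.ι₀ ⊔ SSet.Subcomplex.range SSet.ι₁

open Classical in
/-- The map out of the two ends of a cylinder given by a pair of maps. The two ends are disjoint, so
the map may be defined by cases. -/
noncomputable def descCylinderEnds (f g : X ⟶ Y) : (cylinderEnds X : SSet.{v}) ⟶ Y where
  app n := ↾fun z ↦ if z.1 = (SSet.ι₀ (X := X)).app n z.1.1 then f.app n z.1.1 else g.app n z.1.1
  naturality n m α := by
    ext ⟨z, (⟨x, rfl⟩ | ⟨x, rfl⟩)⟩
    · exact (if_pos rfl).trans ((NatTrans.naturality_apply f α x).trans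
        (congr_arg (Y.map α) (if_pos rfl).symm))
    · exact (if_neg (ι₀_app_ne_ι₁_app _ (X.map α x)).symm).trans
        ((NatTrans.naturality_apply g α x).trans
          (congr_arg (Y.map α) (if_neg (ι₀_app_ne_ι₁_app _ _).symm).symm))

lemma descCylinderEnds_ι₀ (f g : X ⟶ Y) (n : SimplexCategoryᵒᵖ) (x : X.obj n) :
    (descCylinderEnds f g).app n ⟨(SSet.ι₀ (X := X)).app n x, Or.inl ⟨x, rfl⟩⟩ = f.app n x :=
  if_pos rfl

lemma descCylinderEnds_ι₁ (f g : X ⟶ Y) (n : SimplexCategoryᵒᵖ) (x : X.obj n) :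
    (descCylinderEnds f g).app n ⟨(SSet.ι₁ (X := X)).app n x, Or.inr ⟨x, rfl⟩⟩ = g.app n x :=
  if_neg (ι₀_app_ne_ι₁_app _ _).symm

open SSet.modelCategoryQuillen in
/-- A trivial Kan fibration `p` has a section `s`, and `p ≫ s` is homotopic to the identity over
the base; so `p` is a weak equivalence. -/
lemma of_rlp_boundary {p : X ⟶ Y} (hp : I.rlp p) : IsWeakEquivalence p := by
  rw [← SSet.rlp_monomorphisms] at hp
  have lift₁ := hp (⊥ : Y.Subcomplex).ι (inferInstanceAs (Mono _))
  have sq₁ : CommSq (SSet.Subcomplex.isInitialBot.to X) (⊥ : Y.Subcomplex).ι p (𝟙 Y) :=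
    ⟨SSet.Subcomplex.isInitialBot.hom_ext _ _⟩
  obtain ⟨s, hs⟩ : ∃ s : Y ⟶ X, s ≫ p = 𝟙 Y := ⟨sq₁.lift, sq₁.fac_right⟩
  have lift₂ := hp (cylinderEnds X).ι (inferInstanceAs (Mono _))
  have sq₂ : CommSq (descCylinderEnds (p ≫ s) (𝟙 X)) (cylinderEnds X).ι p
      (CartesianMonoidalCategory.fst _ _ ≫ p) := by
    constructor
    ext n ⟨z, (⟨x, rfl⟩ | ⟨x, rfl⟩)⟩
    · exact (congr_arg (p.app n) (descCylinderEnds_ι₀ _ _ n x)).trans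
        (ConcreteCategory.congr_hom (NatTrans.congr_app hs n) (p.app n x))
    · exact congr_arg (p.app n) (descCylinderEnds_ι₁ _ _ n x)
  have h₀ : SSet.ι₀ ≫ sq₂.lift = p ≫ s := by
    ext n x
    exact (ConcreteCategory.congr_hom (NatTrans.congr_app sq₂.fac_left n)
      ⟨(SSet.ι₀ (X := X)).app n x, Or.inl ⟨x, rfl⟩⟩).trans (descCylinderEnds_ι₀ _ _ n x)
  have h₁ : SSet.ι₁ ≫ sq₂.lift = 𝟙 X := by
    ext n x
    exact (ConcreteCategory.congr_hom (NatTrans.congr_app sq₂.fac_left n)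
      ⟨(SSet.ι₁ (X := X)).app n x, Or.inr ⟨x, rfl⟩⟩).trans (descCylinderEnds_ι₁ _ _ n x)
  have rel {Z : SSet.{v}} (h : X ⊗ Δ[1] ⟶ Z) :
      (⊥ : X.Subcomplex).ι ▷ Δ[1] ≫ h = CartesianMonoidalCategory.fst _ _ ≫
        SSet.Subcomplex.isInitialBot.to _ ≫ (⊥ : Z.Subcomplex).ι := by
    ext n ⟨x, hx⟩
    exact x.2.elim
  refine fun Z _ ↦ Function.bijective_iff_has_inverse.mpr
    ⟨HomotopyClasses.precomp s Z, fun x ↦ ?_, fun x ↦ ?_⟩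
  · obtain ⟨g, rfl⟩ := HomotopyClasses.mk_surjective x
    rw [HomotopyClasses.precomp_mk, HomotopyClasses.precomp_mk, reassoc_of% hs]
  · obtain ⟨g, rfl⟩ := HomotopyClasses.mk_surjective x
    rw [HomotopyClasses.precomp_mk, HomotopyClasses.precomp_mk]
    exact HomotopyClasses.sound
      { h := sq₂.lift ≫ g
        h₀ := by
          rw [reassoc_of% h₀]
          rfl
        h₁ := by
          rw [reassoc_of% h₁]
          rfl
        rel := rel _ }

end IsWeakEquivalence

/-! ### Connected components -/

/-- A constant simplicial set is a Kan complex: any two faces of a horn meet, so that all of them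
have the same value. -/
instance kanComplex_const (T : Type v) :
    SSet.KanComplex ((Functor.const SimplexCategoryᵒᵖ).obj T : SSet.{v}) := by
  rw [SSet.KanComplex.iff]
  intro n i f hf
  let val {m : ℕ} (g : Δ[m] ⟶ ((Functor.const SimplexCategoryᵒᵖ).obj T : SSet.{v})) : T :=
    SSet.yonedaEquiv g
  have hval {m : ℕ} (j : Fin (m + 2))
      (g : Δ[m + 1] ⟶ ((Functor.const SimplexCategoryᵒᵖ).obj T : SSet.{v})) :
      val (SSet.stdSimplex.δ j ≫ g) = val g := by
    obtain ⟨x, rfl⟩ := SSet.yonedaEquiv.symm.surjective g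
    rfl
  have key (j k : Fin (n + 2)) (hj : j ≠ i) (hk : k ≠ i) : val (f j hj) = val (f k hk) := by
    wlog hjk : j < k generalizing j k
    · rcases lt_trichotomy j k with h | rfl | h
      · exact this j k hj hk h
      · rfl
      · exact (this k j hk hj h).symm
    obtain _ | n := n
    · exfalso
      lia
    · have := congr_arg val (hf j k hj hk hjk)
      rwa [hval, hval] at this
  obtain ⟨j₀, hj₀⟩ := exists_ne i
  refine ⟨SSet.yonedaEquiv.symm (val (f j₀ hj₀)), fun j hj ↦ SSet.yonedaEquiv.injective ?_⟩
  refine (hval j _).trans ?_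
  simp only [val, Equiv.apply_symm_apply]
  exact key _ _ _ _

/-- All vertices of a simplex lie in the same connected component. -/
lemma π₀_mk_vertex_eq {P : SSet.{v}} {n : SimplexCategory} (p : P.obj (.op n))
    (i j : Fin (n.len + 1)) :
    SSet.π₀.mk (P.map (SimplexCategory.const ⦋0⦌ n i).op p) =
      SSet.π₀.mk (P.map (SimplexCategory.const ⦋0⦌ n j).op p) := by
  wlog hij : i ≤ j generalizing i j
  · exact (this j i (le_of_not_ge hij)).symm
  induction n using SimplexCategory.rec with | _ n
  have h₀ : SimplexCategory.δ 1 ≫ SimplexCategory.mkOfLe i j hij =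
      SimplexCategory.const ⦋0⦌ ⦋n⦌ i := by
    ext k
    fin_cases k
    rfl
  have h₁ : SimplexCategory.δ 0 ≫ SimplexCategory.mkOfLe i j hij =
      SimplexCategory.const ⦋0⦌ ⦋n⦌ j := by
    ext k
    fin_cases k
    rfl
  rw [← h₀, ← h₁, op_comp, op_comp, P.map_comp_apply, P.map_comp_apply]
  exact SSet.π₀.sound (SSet.Edge.mk' (P.map (SimplexCategory.mkOfLe i j hij).op p))

/-- The map to a constant simplicial set given by a function on connected components. -/
noncomputable def toConst {P : SSet.{v}} {T : Type v} (χ : SSet.π₀ P → T) :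
    P ⟶ (Functor.const SimplexCategoryᵒᵖ).obj T where
  app n := ↾fun p ↦ χ (SSet.π₀.mk (P.map (SimplexCategory.const ⦋0⦌ n.unop 0).op p))
  naturality n m α := by
    ext p
    refine congr_arg χ ((congr_arg SSet.π₀.mk (P.map_comp_apply _ _ p).symm).trans ?_)
    exact π₀_mk_vertex_eq p (α.unop.toOrderHom 0) 0

lemma toConst_app_zero {P : SSet.{v}} {T : Type v} (χ : SSet.π₀ P → T) (x : P _⦋0⦌) :
    (toConst χ).app (.op ⦋0⦌) x = χ (SSet.π₀.mk x) := by
  refine congr_arg (χ ∘ SSet.π₀.mk) ?_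
  have : SimplexCategory.const ⦋0⦌ ⦋0⦌ 0 = 𝟙 _ := by
    ext k
    fin_cases k
    rfl
  refine (congr_arg (fun α ↦ P.map (Quiver.Hom.op α) x) this).trans ?_
  simp

/-- Maps to a constant simplicial set only depend on the connected component. -/
lemma π₀_app_eq {P : SSet.{v}} {T : Type v} (g : P ⟶ (Functor.const SimplexCategoryᵒᵖ).obj T)
    {x y : P _⦋0⦌} (e : SSet.π₀.mk x = SSet.π₀.mk y) :
    g.app (.op ⦋0⦌) x = g.app (.op ⦋0⦌) y := by
  have hg : ∀ ⦃x₀ x₁ : P _⦋0⦌⦄ (_ : P.Edge x₀ x₁),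
      g.app (.op ⦋0⦌) x₀ = g.app (.op ⦋0⦌) x₁ := by
    intro x₀ x₁ E
    refine (congr_arg (g.app (.op ⦋0⦌)) E.src_eq).symm.trans
      (Eq.trans ?_ (congr_arg (g.app (.op ⦋0⦌)) E.tgt_eq))
    exact (NatTrans.naturality_apply g (SimplexCategory.δ (1 : Fin 2)).op E.edge).trans
      (NatTrans.naturality_apply g (SimplexCategory.δ (0 : Fin 2)).op E.edge).symm
  exact congr_arg (SSet.π₀.lift (g.app (.op ⦋0⦌)) hg) e

open scoped MonoidalCategory in
/-- Homotopic maps to a constant simplicial set agree. -/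
lemma app_const_eq_of_mk_eq {P : SSet.{v}} {T : Type v}
    {g h : P ⟶ (Functor.const SimplexCategoryᵒᵖ).obj T}
    (e : HomotopyClasses.mk g = HomotopyClasses.mk h) (x : P _⦋0⦌) :
    g.app (.op ⦋0⦌) x = h.app (.op ⦋0⦌) x := by
  have key (a b : P ⟶ (Functor.const SimplexCategoryᵒᵖ).obj T) (H : SSet.Homotopy a b) :
      a.app (.op ⦋0⦌) x = b.app (.op ⦋0⦌) x := by
    let z : (P ⊗ Δ[1] : SSet.{v}) _⦋1⦌ :=
      (P.map (SimplexCategory.const ⦋1⦌ ⦋0⦌ 0).op x, SSet.yonedaEquiv (𝟙 Δ[1]))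
    have hx (i : Fin 2) : P.map (SimplexCategory.const ⦋0⦌ ⦋1⦌ i).op z.1 = x := by
      refine (P.map_comp_apply _ _ x).symm.trans ?_
      have : SimplexCategory.const ⦋0⦌ ⦋1⦌ i ≫ SimplexCategory.const ⦋1⦌ ⦋0⦌ 0 = 𝟙 _ := by
        ext k
        fin_cases k
        rfl
      rw [← op_comp, this]
      exact P.map_id_apply _ x
    have h₀ : (P ⊗ Δ[1] : SSet.{v}).map (SimplexCategory.const ⦋0⦌ ⦋1⦌ 0).op z =
        (SSet.ι₀ (X := P)).app _ x := by
      refine Prod.ext (hx 0) ?_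
      ext k
      rfl
    have h₁ : (P ⊗ Δ[1] : SSet.{v}).map (SimplexCategory.const ⦋0⦌ ⦋1⦌ 1).op z =
        (SSet.ι₁ (X := P)).app _ x := by
      refine Prod.ext (hx 1) ?_
      ext k
      rfl
    refine (ConcreteCategory.congr_hom (NatTrans.congr_app H.h₀ (.op ⦋0⦌)) x).symm.trans
      (Eq.trans ?_ (ConcreteCategory.congr_hom (NatTrans.congr_app H.h₁ (.op ⦋0⦌)) x))
    refine π₀_app_eq H.h ?_
    exact (congr_arg SSet.π₀.mk h₀).symm.trans
      ((π₀_mk_vertex_eq z 0 1).trans (congr_arg SSet.π₀.mk h₁))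
  have := Quot.eqvGen_exact e
  induction this with
  | rel a b H => exact key a b H.some
  | refl => rfl
  | symm a b _ ih => exact (ih (Quot.eqvGen_sound ‹_›)).symm
  | trans a b c _ _ ih₁ ih₂ =>
    exact (ih₁ (Quot.eqvGen_sound ‹_›)).trans (ih₂ (Quot.eqvGen_sound ‹_›))

/-- A weak equivalence induces a bijection on connected components: constant simplicial sets are
Kan complexes, and maps into them are functions on connected components. -/
lemma IsWeakEquivalence.bijective_mapπ₀ {P Q : SSet.{v}} {t : P ⟶ Q} (ht : IsWeakEquivalence t) :
    Function.Bijective (SSet.mapπ₀ t) := by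
  constructor
  · -- The identity of `π₀ P` extends along `t` to a function on `π₀ Q`.
    intro x y hxy
    obtain ⟨x, rfl⟩ := SSet.π₀.mk_surjective x
    obtain ⟨y, rfl⟩ := SSet.π₀.mk_surjective y
    obtain ⟨c, hc⟩ := (ht ((Functor.const SimplexCategoryᵒᵖ).obj (SSet.π₀ P))).2
      (.mk (toConst id))
    obtain ⟨r, rfl⟩ := HomotopyClasses.mk_surjective c
    rw [HomotopyClasses.precomp_mk] at hc
    have hx := app_const_eq_of_mk_eq hc x
    have hy := app_const_eq_of_mk_eq hc y
    rw [toConst_app_zero] at hx hy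
    exact hx.symm.trans ((π₀_app_eq r hxy).trans hy)
  · -- The characteristic function of the image becomes constant on `π₀ P`.
    intro y
    obtain ⟨y, rfl⟩ := SSet.π₀.mk_surjective y
    have := (ht ((Functor.const SimplexCategoryᵒᵖ).obj (ULift.{v} Prop))).1
      (a₁ := .mk (toConst fun c ↦ ⟨c ∈ Set.range (SSet.mapπ₀ t)⟩))
      (a₂ := .mk (toConst fun _ ↦ ⟨True⟩)) (by
        rw [HomotopyClasses.precomp_mk, HomotopyClasses.precomp_mk]
        congr 1
        ext n p
        refine congr_arg ULift.up (eq_true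
          ⟨SSet.π₀.mk (P.map (SimplexCategory.const ⦋0⦌ n.unop 0).op p), ?_⟩)
        exact congr_arg SSet.π₀.mk (NatTrans.naturality_apply t _ p))
    have := app_const_eq_of_mk_eq this y
    rw [toConst_app_zero, toConst_app_zero] at this
    exact of_eq_true (congr_arg ULift.down this)

end SimplicialSets

/-! ### Lifting against maps to pullbacks and from pushouts -/

section

variable {C : Type u} [Category.{v} C]

lemma hasLiftingProperty_pullbackLift_iff {K L X P Q R : C} (i : K ⟶ L) {f : X ⟶ P} {g : X ⟶ Q}
    {p : P ⟶ R} {q : Q ⟶ R} [HasPullback p q] (h : f ≫ p = g ≫ q) :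
    HasLiftingProperty i (pullback.lift f g h) ↔
      ∀ (ℓ : K ⟶ X) (a : L ⟶ Q) (b : L ⟶ P), i ≫ a = ℓ ≫ g → i ≫ b = ℓ ≫ f → b ≫ p = a ≫ q →
        ∃ c : L ⟶ X, i ≫ c = ℓ ∧ c ≫ g = a ∧ c ≫ f = b := by
  constructor
  · intro H ℓ a b h₁ h₂ h₃
    have sq : CommSq ℓ i (pullback.lift f g h) (pullback.lift b a h₃) :=
      ⟨by
        apply pullback.hom_ext
        · rw [Category.assoc, Category.assoc, pullback.lift_fst, pullback.lift_fst, h₂]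
        · rw [Category.assoc, Category.assoc, pullback.lift_snd, pullback.lift_snd, h₁]⟩
    refine ⟨sq.lift, sq.fac_left, ?_, ?_⟩
    · have := congr_arg (· ≫ pullback.snd _ _) sq.fac_right
      rwa [Category.assoc, pullback.lift_snd, pullback.lift_snd] at this
    · have := congr_arg (· ≫ pullback.fst _ _) sq.fac_right
      rwa [Category.assoc, pullback.lift_fst, pullback.lift_fst] at this
  · intro H
    refine ⟨fun {ℓ r} sq ↦ ?_⟩
    obtain ⟨c, h₁, h₂, h₃⟩ := H ℓ (r ≫ pullback.snd _ _) (r ≫ pullback.fst _ _)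
      (by rw [← reassoc_of% sq.w, pullback.lift_snd])
      (by rw [← reassoc_of% sq.w, pullback.lift_fst])
      (by rw [Category.assoc, Category.assoc, pullback.condition])
    exact ⟨⟨{ l := c, fac_left := h₁, fac_right := by
                apply pullback.hom_ext
                · rw [Category.assoc, pullback.lift_fst, h₃]
                · rw [Category.assoc, pullback.lift_snd, h₂] }⟩⟩

lemma hasLiftingProperty_pushoutDesc_iff {X P Q R K L : C} (i : K ⟶ L) {f : P ⟶ X} {g : Q ⟶ X}
    {p : R ⟶ P} {q : R ⟶ Q} [HasPushout p q] (h : p ≫ f = q ≫ g) :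
    HasLiftingProperty (pushout.desc f g h) i ↔
      ∀ (ℓ : P ⟶ K) (a : Q ⟶ K) (b : X ⟶ L), q ≫ a = p ≫ ℓ → f ≫ b = ℓ ≫ i → g ≫ b = a ≫ i →
        ∃ c : X ⟶ K, f ≫ c = ℓ ∧ g ≫ c = a ∧ c ≫ i = b := by
  constructor
  · intro H ℓ a b h₁ h₂ h₃
    have sq : CommSq (pushout.desc ℓ a h₁.symm) (pushout.desc f g h) i b :=
      ⟨by
        apply pushout.hom_ext
        · rw [← Category.assoc, ← Category.assoc, pushout.inl_desc, pushout.inl_desc, h₂]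
        · rw [← Category.assoc, ← Category.assoc, pushout.inr_desc, pushout.inr_desc, h₃]⟩
    refine ⟨sq.lift, ?_, ?_, sq.fac_right⟩
    · have := congr_arg (pushout.inl _ _ ≫ ·) sq.fac_left
      rwa [← Category.assoc, pushout.inl_desc, pushout.inl_desc] at this
    · have := congr_arg (pushout.inr _ _ ≫ ·) sq.fac_left
      rwa [← Category.assoc, pushout.inr_desc, pushout.inr_desc] at this
  · intro H
    refine ⟨fun {ℓ r} sq ↦ ?_⟩
    obtain ⟨c, h₁, h₂, h₃⟩ := H (pushout.inl _ _ ≫ ℓ) (pushout.inr _ _ ≫ ℓ) r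
      (by rw [← Category.assoc, ← Category.assoc, pushout.condition])
      (by rw [Category.assoc, sq.w, ← Category.assoc, pushout.inl_desc])
      (by rw [Category.assoc, sq.w, ← Category.assoc, pushout.inr_desc])
    exact ⟨⟨{ l := c, fac_right := h₃, fac_left := by
                apply pushout.hom_ext
                · rw [← Category.assoc, pushout.inl_desc, h₁]
                · rw [← Category.assoc, pushout.inr_desc, h₂] }⟩⟩

end

/-! ### Latching objects and boundaries of simplices -/

namespace Reedy

variable {M : Type u} [Category.{v} M] [HasFiniteColimits M]

/-- The latching object `L_n A` of a cosimplicial object. -/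
noncomputable abbrev latchingObj (A : CosimplicialObject M) (n : ℕ) : M :=
  colimit (latchingDiagram A n)

/-- The map `L_n A ⟶ L_n B` induced by a map of cosimplicial objects. -/
noncomputable def latchingObjMap {A B : CosimplicialObject M} (g : A ⟶ B) (n : ℕ) :
    latchingObj A n ⟶ latchingObj B n :=
  colimMap (Functor.whiskerLeft (inducedFunctor _ ⋙ Over.forget _) g)

/-- The map `A^d ⟶ L_n A` given by an injective map `⦋d⦌ ⟶ ⦋n⦌` with `d < n`. -/
noncomputable def latchingι (A : CosimplicialObject M) {n : ℕ} {d : SimplexCategory} (i : d ⟶ ⦋n⦌)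
    [Mono i] (h : d.len < n) : A.obj d ⟶ latchingObj A n :=
  colimit.ι (latchingDiagram A n) (⟨⟨d.len, h⟩, ⟨i, inferInstance⟩⟩ : LatchingIndex n)

lemma map_latchingι (A : CosimplicialObject M) {n : ℕ} {d d' : SimplexCategory} (i : d ⟶ ⦋n⦌)
    [Mono i] (h : d.len < n) (i' : d' ⟶ ⦋n⦌) [Mono i'] (h' : d'.len < n) (e : d ⟶ d')
    (fac : e ≫ i' = i) : A.map e ≫ latchingι A i' h' = latchingι A i h := by
  let x : LatchingIndex n := ⟨⟨d.len, h⟩, ⟨i, inferInstance⟩⟩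
  let y : LatchingIndex n := ⟨⟨d'.len, h'⟩, ⟨i', inferInstance⟩⟩
  let φ : (show LatchingCategory n from x) ⟶ y := InducedCategory.homMk (Over.homMk e fac)
  exact colimit.w (latchingDiagram A n) φ

lemma latchingι_latchingMap (A : CosimplicialObject M) {n : ℕ} {d : SimplexCategory} (i : d ⟶ ⦋n⦌)
    [Mono i] (h : d.len < n) : latchingι A i h ≫ latchingMap A n = A.map i :=
  colimit.ι_desc _ _

lemma latchingι_latchingObjMap {A B : CosimplicialObject M} (g : A ⟶ B) {n : ℕ}
    {d : SimplexCategory} (i : d ⟶ ⦋n⦌) [Mono i] (h : d.len < n) :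
    latchingι A i h ≫ latchingObjMap g n = g.app d ≫ latchingι B i h :=
  ι_colimMap _ _

lemma latchingObj_hom_ext {A : CosimplicialObject M} {n : ℕ} {Z : M} {φ ψ : latchingObj A n ⟶ Z}
    (h : ∀ (d : SimplexCategory) (i : d ⟶ ⦋n⦌) [Mono i] (hd : d.len < n),
      latchingι A i hd ≫ φ = latchingι A i hd ≫ ψ) : φ = ψ := by
  refine colimit.hom_ext fun x ↦ ?_
  have := x.2.2
  exact h _ x.2.1 x.1.2

lemma latchingObjMap_latchingMap {A B : CosimplicialObject M} (g : A ⟶ B) (n : ℕ) :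
    latchingObjMap g n ≫ latchingMap B n = latchingMap A n ≫ g.app ⦋n⦌ := by
  refine latchingObj_hom_ext fun d i _ hd ↦ ?_
  rw [reassoc_of% latchingι_latchingObjMap g i hd, latchingι_latchingMap,
    reassoc_of% latchingι_latchingMap A i hd, g.naturality]

lemma latchingObjMap_comp {A B D : CosimplicialObject M} (g : A ⟶ B) (h : B ⟶ D) (n : ℕ) :
    latchingObjMap (g ≫ h) n = latchingObjMap g n ≫ latchingObjMap h n := by
  refine latchingObj_hom_ext fun d i _ hd ↦ ?_
  rw [reassoc_of% latchingι_latchingObjMap g i hd, latchingι_latchingObjMap,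
    latchingι_latchingObjMap]
  exact Category.assoc _ _ _

lemma len_image_lt {n : ℕ} {k : SimplexCategory} (α : k ⟶ ⦋n⦌)
    (hα : ¬ Function.Surjective α.toOrderHom) : (image α).len < n := by
  refine lt_of_le_of_ne (SimplexCategory.len_le_of_mono (image.ι α)) fun h ↦ hα ?_
  rw [← SimplexCategory.epi_iff_surjective]
  have : IsIso (image.ι α) := by
    have hι : Mono (image.ι α) := inferInstance
    generalize image.ι α = i at hι
    generalize image α = d at i h
    induction d using SimplexCategory.rec with | _ d
    exact (SimplexCategory.isIso_iff_of_mono i).mpr h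
  rw [← image.fac α]
  infer_instance

/-- The map `A^k ⟶ L_n A` given by a map `⦋k⦌ ⟶ ⦋n⦌` that is not surjective. -/
noncomputable def latchingη (A : CosimplicialObject M) {n : ℕ} {k : SimplexCategory} (α : k ⟶ ⦋n⦌)
    (hα : ¬ Function.Surjective α.toOrderHom) : A.obj k ⟶ latchingObj A n :=
  A.map (factorThruImage α) ≫ latchingι A (image.ι α) (len_image_lt α hα)

lemma latchingη_latchingMap (A : CosimplicialObject M) {n : ℕ} {k : SimplexCategory} (α : k ⟶ ⦋n⦌)
    (hα : ¬ Function.Surjective α.toOrderHom) :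
    latchingη A α hα ≫ latchingMap A n = A.map α := by
  rw [latchingη, Category.assoc, latchingι_latchingMap, ← A.map_comp, image.fac]

lemma latchingη_of_mono (A : CosimplicialObject M) {n : ℕ} {k : SimplexCategory} (α : k ⟶ ⦋n⦌)
    [Mono α] (hα : ¬ Function.Surjective α.toOrderHom) (h : k.len < n) :
    latchingη A α hα = latchingι A α h :=
  map_latchingι A α h _ _ _ (image.fac α)

lemma map_latchingη (A : CosimplicialObject M) {n : ℕ} {k l : SimplexCategory} (β : l ⟶ k)
    (α : k ⟶ ⦋n⦌) (hα : ¬ Function.Surjective α.toOrderHom)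
    (hβα : ¬ Function.Surjective (β ≫ α).toOrderHom) :
    A.map β ≫ latchingη A α hα = latchingη A (β ≫ α) hβα := by
  rw [latchingη, latchingη,
    ← map_latchingι A (image.ι (β ≫ α)) (len_image_lt _ hβα) (image.ι α) (len_image_lt _ hα)
      (image.preComp β α) (image.preComp_ι β α),
    ← Category.assoc, ← Category.assoc, ← A.map_comp, ← A.map_comp, image.factorThruImage_preComp]

lemma latchingη_latchingObjMap {A B : CosimplicialObject M} (g : A ⟶ B) {n : ℕ}
    {k : SimplexCategory} (α : k ⟶ ⦋n⦌) (hα : ¬ Function.Surjective α.toOrderHom) :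
    latchingη A α hα ≫ latchingObjMap g n = g.app k ≫ latchingη B α hα := by
  rw [latchingη, latchingη, Category.assoc, latchingι_latchingObjMap, g.naturality_assoc]

end Reedy

namespace ModelStructure

open Reedy

variable {M : Type u} [Category.{v} M]

/-- The map `M(A^•, Z) ⟶ M(A^•, W)` induced by a map `Z ⟶ W`. -/
def mappingComplexPost (A : CosimplicialObject M) {Z W : M} (p : Z ⟶ W) :
    mappingComplex A Z ⟶ mappingComplex A W :=
  Functor.whiskerLeft A.op (yoneda.map p)

section

variable {A B D : CosimplicialObject M} {Z W : M}

lemma mappingComplexMap_id (X : M) : mappingComplexMap (𝟙 A) X = 𝟙 _ := by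
  ext n x
  exact Category.id_comp x

lemma mappingComplexMap_comp (g : A ⟶ B) (h : B ⟶ D) (X : M) :
    mappingComplexMap (g ≫ h) X = mappingComplexMap h X ≫ mappingComplexMap g X := by
  ext n x
  exact Category.assoc _ _ x

lemma mappingComplex_comm (g : A ⟶ B) (p : Z ⟶ W) :
    mappingComplexPost B p ≫ mappingComplexMap g W =
      mappingComplexMap g Z ≫ mappingComplexPost A p := by
  ext n x
  exact (Category.assoc _ x p).symm

/-- The map `A^n ⟶ Z` corresponding to an `n`-simplex of `M(A^•, Z)`. -/
def simplexEquiv (A : CosimplicialObject M) (n : ℕ) (Z : M) :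
    (Δ[n] ⟶ mappingComplex A Z) ≃ (A.obj ⦋n⦌ ⟶ Z) :=
  SSet.yonedaEquiv

lemma simplexEquiv_comp_post {n : ℕ} (s : Δ[n] ⟶ mappingComplex A Z) (p : Z ⟶ W) :
    simplexEquiv A n W (s ≫ mappingComplexPost A p) = simplexEquiv A n Z s ≫ p := rfl

lemma simplexEquiv_comp_map {n : ℕ} (s : Δ[n] ⟶ mappingComplex B Z) (g : A ⟶ B) :
    simplexEquiv A n Z (s ≫ mappingComplexMap g Z) = g.app ⦋n⦌ ≫ simplexEquiv B n Z s := rfl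

end

lemma not_surjective_of_lt {n : ℕ} {d : SimplexCategory} (i : d ⟶ ⦋n⦌) (h : d.len < n) :
    ¬ Function.Surjective i.toOrderHom := by
  intro hi
  rw [← SimplexCategory.epi_iff_surjective] at hi
  exact absurd (SimplexCategory.len_le_of_epi i) (not_le.mpr h)

/-- The map `A^k ⟶ Z` which a map `∂Δ[n] ⟶ M(A^•, Z)` assigns to a map `⦋k⦌ ⟶ ⦋n⦌` that is not
surjective. -/
def boundaryApp {A : CosimplicialObject M} {n : ℕ} {Z : M}
    (s : (SSet.boundary.{v} n : SSet.{v}) ⟶ mappingComplex A Z) {k : SimplexCategory}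
    (α : k ⟶ ⦋n⦌) (hα : ¬ Function.Surjective α.toOrderHom) : A.obj k ⟶ Z :=
  s.app (.op k) ⟨SSet.stdSimplex.objEquiv.symm α, hα⟩

lemma map_boundaryApp {A : CosimplicialObject M} {n : ℕ} {Z : M}
    (s : (SSet.boundary.{v} n : SSet.{v}) ⟶ mappingComplex A Z) {k l : SimplexCategory}
    (β : l ⟶ k) (α : k ⟶ ⦋n⦌) (hα : ¬ Function.Surjective α.toOrderHom) {γ : l ⟶ ⦋n⦌}
    (fac : β ≫ α = γ) (hγ : ¬ Function.Surjective γ.toOrderHom) :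
    A.map β ≫ boundaryApp s α hα = boundaryApp s γ hγ := by
  subst fac
  exact (NatTrans.naturality_apply s β.op (⟨SSet.stdSimplex.objEquiv.symm α, hα⟩ :
    (SSet.boundary.{v} n : SSet.{v}).obj (.op k))).symm

lemma boundary_hom_ext {A : CosimplicialObject M} {n : ℕ} {Z : M}
    {s t : (SSet.boundary.{v} n : SSet.{v}) ⟶ mappingComplex A Z}
    (h : ∀ (k : SimplexCategory) (α : k ⟶ ⦋n⦌) (hα : ¬ Function.Surjective α.toOrderHom),
      boundaryApp s α hα = boundaryApp t α hα) : s = t := by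
  ext k ⟨x, hx⟩
  exact h k.unop (SSet.stdSimplex.objEquiv x) hx

variable [HasFiniteColimits M]

/-- Maps `L_n A ⟶ Z` are the same as maps `∂Δ[n] ⟶ M(A^•, Z)`. -/
noncomputable def boundaryEquiv (A : CosimplicialObject M) (n : ℕ) (Z : M) :
    ((SSet.boundary.{v} n : SSet.{v}) ⟶ mappingComplex A Z) ≃ (latchingObj A n ⟶ Z) where
  toFun s := colimit.desc (latchingDiagram A n)
    { pt := Z
      ι :=
        { app := fun x ↦ boundaryApp s x.2.1 (not_surjective_of_lt _ x.1.2)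
          naturality := fun x y g ↦ (map_boundaryApp s g.hom.left y.2.1
            (not_surjective_of_lt _ y.1.2) (Over.w g.hom) (not_surjective_of_lt _ x.1.2)).trans
              (Category.comp_id _).symm } }
  invFun φ :=
    { app := fun k ↦ ↾fun x ↦ latchingη A (SSet.stdSimplex.objEquiv x.1) x.2 ≫ φ
      naturality := fun k l β ↦ by
        ext x
        refine Eq.trans ?_ (Category.assoc _ _ _)
        exact congr_arg (· ≫ φ) (map_latchingη A β.unop _ x.2 _).symm }
  left_inv s := by
    refine boundary_hom_ext fun k α hα ↦ ?_
    refine (Category.assoc _ _ _).trans ?_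
    exact (congr_arg _ (colimit.ι_desc _ _)).trans (map_boundaryApp s _ _ _ (image.fac α) hα)
  right_inv φ := by
    refine latchingObj_hom_ext fun d i _ hd ↦ ?_
    refine (colimit.ι_desc _ _).trans ?_
    exact congr_arg (· ≫ φ) (latchingη_of_mono A i (not_surjective_of_lt _ hd) hd)

section

variable {A B : CosimplicialObject M} {n : ℕ} {Z W : M}

lemma latchingι_boundaryEquiv (s : (SSet.boundary.{v} n : SSet.{v}) ⟶ mappingComplex A Z)
    {d : SimplexCategory} (i : d ⟶ ⦋n⦌) [Mono i] (hd : d.len < n) :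
    latchingι A i hd ≫ boundaryEquiv A n Z s = boundaryApp s i (not_surjective_of_lt _ hd) :=
  colimit.ι_desc _ _

lemma boundaryEquiv_comp_post (s : (SSet.boundary.{v} n : SSet.{v}) ⟶ mappingComplex A Z)
    (p : Z ⟶ W) :
    boundaryEquiv A n W (s ≫ mappingComplexPost A p) = boundaryEquiv A n Z s ≫ p := by
  refine latchingObj_hom_ext fun d i _ hd ↦ ?_
  rw [latchingι_boundaryEquiv, reassoc_of% latchingι_boundaryEquiv s i hd]
  rfl

lemma boundaryEquiv_comp_map (s : (SSet.boundary.{v} n : SSet.{v}) ⟶ mappingComplex B Z)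
    (g : A ⟶ B) :
    boundaryEquiv A n Z (s ≫ mappingComplexMap g Z) =
      latchingObjMap g n ≫ boundaryEquiv B n Z s := by
  refine latchingObj_hom_ext fun d i _ hd ↦ ?_
  rw [latchingι_boundaryEquiv, reassoc_of% latchingι_latchingObjMap g i hd, latchingι_boundaryEquiv]
  rfl

lemma boundaryEquiv_ι_comp (s : Δ[n] ⟶ mappingComplex A Z) :
    boundaryEquiv A n Z ((SSet.boundary.{v} n).ι ≫ s) =
      latchingMap A n ≫ simplexEquiv A n Z s := by
  refine latchingObj_hom_ext fun d i _ hd ↦ ?_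
  rw [latchingι_boundaryEquiv, reassoc_of% latchingι_latchingMap A i hd]
  obtain ⟨x, rfl⟩ := SSet.yonedaEquiv.symm.surjective s
  refine Eq.trans ?_ (congr_arg (A.map i ≫ ·) (SSet.yonedaEquiv.apply_symm_apply x)).symm
  rfl

end

end ModelStructure

/-! ### Relative latching maps and lifting properties -/

namespace ModelStructure

open Reedy

variable {M : Type u} [Category.{v} M]

/-- The map `M(B^•, Z) ⟶ M(B^•, W) ×_{M(A^•, W)} M(A^•, Z)` given by maps `A^• ⟶ B^•` and
`Z ⟶ W`. -/
noncomputable def leibnizHom {A B : CosimplicialObject M} (g : A ⟶ B) {Z W : M} (p : Z ⟶ W) :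
    mappingComplex B Z ⟶ pullback (mappingComplexMap g W) (mappingComplexPost A p) :=
  pullback.lift (mappingComplexPost B p) (mappingComplexMap g Z) (mappingComplex_comm g p)

lemma hasLiftingProperty_leibnizHom_iff {A B : CosimplicialObject M} (g : A ⟶ B) {Z W : M}
    (p : Z ⟶ W) {K L : SSet.{v}} (i : K ⟶ L) :
    HasLiftingProperty i (leibnizHom g p) ↔
      ∀ (ℓ : K ⟶ mappingComplex B Z) (a : L ⟶ mappingComplex A Z) (b : L ⟶ mappingComplex B W),
        i ≫ a = ℓ ≫ mappingComplexMap g Z → i ≫ b = ℓ ≫ mappingComplexPost B p →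
        b ≫ mappingComplexMap g W = a ≫ mappingComplexPost A p →
        ∃ c : L ⟶ mappingComplex B Z, i ≫ c = ℓ ∧ c ≫ mappingComplexMap g Z = a ∧
          c ≫ mappingComplexPost B p = b :=
  hasLiftingProperty_pullbackLift_iff i _

variable [HasFiniteColimits M]

/-- The relative latching map `A^n ⊔_{L_n A} L_n B ⟶ B^n`. -/
noncomputable def relativeLatchingMap {A B : CosimplicialObject M} (g : A ⟶ B) (n : ℕ) :
    pushout (latchingObjMap g n) (latchingMap A n) ⟶ B.obj ⦋n⦌ :=
  pushout.desc (latchingMap B n) (g.app ⦋n⦌) (latchingObjMap_latchingMap g n)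

lemma hasLiftingProperty_relativeLatchingMap_iff {A B : CosimplicialObject M} (g : A ⟶ B) (n : ℕ)
    {Z W : M} (p : Z ⟶ W) :
    HasLiftingProperty (relativeLatchingMap g n) p ↔
      ∀ (ℓ : latchingObj B n ⟶ Z) (a : A.obj ⦋n⦌ ⟶ Z) (b : B.obj ⦋n⦌ ⟶ W),
        latchingMap A n ≫ a = latchingObjMap g n ≫ ℓ → latchingMap B n ≫ b = ℓ ≫ p →
        g.app ⦋n⦌ ≫ b = a ≫ p →
        ∃ c : B.obj ⦋n⦌ ⟶ Z, latchingMap B n ≫ c = ℓ ∧ g.app ⦋n⦌ ≫ c = a ∧ c ≫ p = b :=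
  hasLiftingProperty_pushoutDesc_iff p _

/-- Lifting a boundary inclusion against the Leibniz map is lifting the relative latching map. -/
lemma hasLiftingProperty_boundary_leibnizHom_iff {A B : CosimplicialObject M} (g : A ⟶ B) (n : ℕ)
    {Z W : M} (p : Z ⟶ W) :
    HasLiftingProperty (SSet.boundary.{v} n).ι (leibnizHom g p) ↔
      HasLiftingProperty (relativeLatchingMap g n) p := by
  rw [hasLiftingProperty_leibnizHom_iff, hasLiftingProperty_relativeLatchingMap_iff]
  rw [(boundaryEquiv B n Z).forall_congr_left]
  refine forall_congr' fun ℓ ↦ ?_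
  rw [(simplexEquiv A n Z).forall_congr_left]
  refine forall_congr' fun a ↦ ?_
  rw [(simplexEquiv B n W).forall_congr_left]
  refine forall_congr' fun b ↦ ?_
  rw [(simplexEquiv B n Z).exists_congr_left]
  simp only [← (boundaryEquiv A n Z).apply_eq_iff_eq, ← (boundaryEquiv B n W).apply_eq_iff_eq,
    ← (boundaryEquiv B n Z).apply_eq_iff_eq,
    ← (simplexEquiv A n W).apply_eq_iff_eq, ← (simplexEquiv A n Z).apply_eq_iff_eq,
    ← (simplexEquiv B n W).apply_eq_iff_eq,
    boundaryEquiv_ι_comp, boundaryEquiv_comp_map, boundaryEquiv_comp_post, simplexEquiv_comp_map,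
    simplexEquiv_comp_post, Equiv.apply_symm_apply]

/-- Lifting a boundary inclusion in mapping complexes is lifting the latching map. -/
lemma hasLiftingProperty_boundary_post_iff (A : CosimplicialObject M) (n : ℕ)
    {Z W : M} (p : Z ⟶ W) :
    HasLiftingProperty (SSet.boundary.{v} n).ι (mappingComplexPost A p) ↔
      HasLiftingProperty (latchingMap A n) p := by
  constructor
  · intro h
    refine ⟨fun {ℓ b} sq ↦ ?_⟩
    have sq' : CommSq ((boundaryEquiv A n Z).symm ℓ) (SSet.boundary.{v} n).ι
        (mappingComplexPost A p) ((simplexEquiv A n W).symm b) :=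
      ⟨(boundaryEquiv A n W).injective (by
        rw [boundaryEquiv_comp_post, boundaryEquiv_ι_comp, Equiv.apply_symm_apply,
          Equiv.apply_symm_apply, sq.w])⟩
    refine ⟨⟨{ l := simplexEquiv A n Z sq'.lift, fac_left := ?_, fac_right := ?_ }⟩⟩
    · rw [← boundaryEquiv_ι_comp, sq'.fac_left, Equiv.apply_symm_apply]
    · rw [← simplexEquiv_comp_post, sq'.fac_right, Equiv.apply_symm_apply]
  · intro h
    refine ⟨fun {ℓ b} sq ↦ ?_⟩
    have sq' : CommSq (boundaryEquiv A n Z ℓ) (latchingMap A n) p (simplexEquiv A n W b) :=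
      ⟨by rw [← boundaryEquiv_comp_post, sq.w, boundaryEquiv_ι_comp]⟩
    refine ⟨⟨{ l := (simplexEquiv A n Z).symm sq'.lift, fac_left := ?_, fac_right := ?_ }⟩⟩
    · apply (boundaryEquiv A n Z).injective
      rw [boundaryEquiv_ι_comp, Equiv.apply_symm_apply, sq'.fac_left]
    · apply (simplexEquiv A n W).injective
      rw [simplexEquiv_comp_post, Equiv.apply_symm_apply, sq'.fac_right]

end ModelStructure

/-! ### Model structures passed explicitly -/

namespace ModelStructure

section

variable {M : Type u} [Category.{v} M] (S : ModelCategory M)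

lemma cof_iff {A B : M} (i : A ⟶ B) :
    Cof S i ↔ ∀ ⦃Z Y : M⦄ (p : Z ⟶ Y), Fib S p → W S p → HasLiftingProperty i p := by
  let := S
  have : Cof S = (trivialFibrations M).llp := (trivialFibrations_llp M).symm
  rw [this]
  exact ⟨fun h Z Y p h₁ h₂ ↦ h p ⟨h₁, h₂⟩, fun h Z Y p hp ↦ h p hp.1 hp.2⟩

lemma trivialCof_iff {A B : M} (i : A ⟶ B) :
    (Cof S i ∧ W S i) ↔ ∀ ⦃Z Y : M⦄ (p : Z ⟶ Y), Fib S p → HasLiftingProperty i p := by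
  let := S
  have : (fibrations M).llp = trivialCofibrations M := fibrations_llp M
  exact ⟨fun h ↦ (this.symm.le _ h : _), fun h ↦ this.le _ h⟩

lemma fib_iff {X Y : M} (p : X ⟶ Y) :
    Fib S p ↔ ∀ ⦃A B : M⦄ (i : A ⟶ B), Cof S i → W S i → HasLiftingProperty i p := by
  let := S
  have : (trivialCofibrations M).rlp = fibrations M := trivialCofibrations_rlp M
  exact ⟨fun h A B i h₁ h₂ ↦ this.symm.le _ h i ⟨h₁, h₂⟩,
    fun h ↦ this.le _ fun A B i hi ↦ h i hi.1 hi.2⟩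

lemma trivialFib_iff {X Y : M} (p : X ⟶ Y) :
    (Fib S p ∧ W S p) ↔ ∀ ⦃A B : M⦄ (i : A ⟶ B), Cof S i → HasLiftingProperty i p := by
  let := S
  have : (cofibrations M).rlp = trivialFibrations M := cofibrations_rlp M
  exact ⟨fun h ↦ (this.symm.le _ h : _), fun h ↦ this.le _ h⟩

lemma fibrant_iff (X : M) :
    Fibrant S X ↔
      ∀ ⦃A B : M⦄ (i : A ⟶ B), Cof S i → W S i → ∀ f : A ⟶ X, ∃ g : B ⟶ X, i ≫ g = f := by
  let := S
  rw [show Fibrant S X ↔ Fib S (terminal.from X) from fibration_iff _, fib_iff]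
  refine forall_congr' fun A ↦ forall_congr' fun B ↦ forall_congr' fun i ↦ forall_congr' fun _ ↦
    forall_congr' fun _ ↦ ⟨fun h f ↦ ?_, fun h ↦ ⟨fun {f b} sq ↦ ?_⟩⟩
  · have sq : CommSq f i (terminal.from X) (terminal.from B) := ⟨terminal.hom_ext _ _⟩
    exact ⟨sq.lift, sq.fac_left⟩
  · obtain ⟨g, hg⟩ := h f
    exact ⟨⟨{ l := g, fac_left := hg, fac_right := terminal.hom_ext _ _ }⟩⟩

instance : (W S).HasTwoOutOfThreeProperty := S.cm2

lemma exists_factorization_cof_trivialFib {X Y : M} (f : X ⟶ Y) :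
    ∃ (Z : M) (i : X ⟶ Z) (p : Z ⟶ Y), Cof S i ∧ Fib S p ∧ W S p ∧ i ≫ p = f := by
  let := S
  have d := MorphismProperty.factorizationData (cofibrations M) (trivialFibrations M) f
  exact ⟨d.Z, d.i, d.p, d.hi, d.hp.1, d.hp.2, d.fac⟩

lemma exists_factorization_trivialCof_fib {X Y : M} (f : X ⟶ Y) :
    ∃ (Z : M) (i : X ⟶ Z) (p : Z ⟶ Y), Cof S i ∧ W S i ∧ Fib S p ∧ i ≫ p = f := by
  let := S
  have d := MorphismProperty.factorizationData (trivialCofibrations M) (fibrations M) f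
  exact ⟨d.Z, d.i, d.p, d.hi.1, d.hi.2, d.hp, d.fac⟩

end

/-! ### Reedy cofibrations -/

section

open Reedy SSet.modelCategoryQuillen

variable {M : Type u} [Category.{v} M] (S : ModelCategory M)

/-- A map of cosimplicial objects is a Reedy cofibration if its relative latching maps are
cofibrations (see `reedyCofibration_iff`). This is phrased as a lifting property of maps of mapping
complexes. -/
def ReedyCofibration {A B : CosimplicialObject M} (g : A ⟶ B) : Prop :=
  ∀ (n : ℕ) ⦃Z Y : M⦄ (p : Z ⟶ Y), Fib S p → W S p →
    HasLiftingProperty (SSet.boundary.{v} n).ι (leibnizHom g p)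

lemma reedyCofibration_iff [HasFiniteColimits M] {A B : CosimplicialObject M} (g : A ⟶ B) :
    ReedyCofibration S g ↔ ∀ n, Cof S (relativeLatchingMap g n) := by
  simp only [ReedyCofibration, cof_iff, hasLiftingProperty_boundary_leibnizHom_iff]

lemma reedyCofibrant_iff (A : CosimplicialObject M) :
    ReedyCofibrant S A ↔ ∀ (n : ℕ) ⦃Z Y : M⦄ (p : Z ⟶ Y), Fib S p → W S p →
      HasLiftingProperty (SSet.boundary.{v} n).ι (mappingComplexPost A p) := by
  let := S
  simp only [hasLiftingProperty_boundary_post_iff]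
  simp only [ReedyCofibrant, cof_iff]

lemma rlp_I_iff {X Y : SSet.{v}} (f : X ⟶ Y) :
    I.rlp f ↔ ∀ n, HasLiftingProperty (SSet.boundary.{v} n).ι f := by
  refine ⟨fun h n ↦ h _ (boundary_ι_mem_I n), fun h K L i hi ↦ ?_⟩
  obtain ⟨n⟩ := hi
  exact h n

variable {S} {A B D : CosimplicialObject M}

lemma ReedyCofibration.comp {g : A ⟶ B} {h : B ⟶ D} (hg : ReedyCofibration S g)
    (hh : ReedyCofibration S h) : ReedyCofibration S (g ≫ h) := by
  intro n Z Y p hp hp'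
  have h₁ := hg n p hp hp'
  have h₂ := hh n p hp hp'
  rw [hasLiftingProperty_leibnizHom_iff] at h₁ h₂ ⊢
  intro ℓ a b hℓa hℓb hab
  rw [mappingComplexMap_comp] at hℓa hab
  obtain ⟨c, hc₁, hc₂, hc₃⟩ := h₁ (ℓ ≫ mappingComplexMap h Z) a (b ≫ mappingComplexMap h Y)
    (by rw [hℓa, Category.assoc])
    (by rw [reassoc_of% hℓb, Category.assoc, mappingComplex_comm])
    (by rw [Category.assoc, hab])
  obtain ⟨d, hd₁, hd₂, hd₃⟩ := h₂ ℓ c b hc₁ hℓb hc₃.symm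
  exact ⟨d, hd₁, by rw [mappingComplexMap_comp, reassoc_of% hd₂, hc₂], hd₃⟩

lemma ReedyCofibration.reedyCofibrant {g : A ⟶ B} (hg : ReedyCofibration S g)
    (hA : ReedyCofibrant S A) : ReedyCofibrant S B := by
  rw [reedyCofibrant_iff] at hA ⊢
  intro n Z Y p hp hp'
  have h₁ := hA n p hp hp'
  have h₂ := hg n p hp hp'
  rw [hasLiftingProperty_leibnizHom_iff] at h₂
  refine ⟨fun {ℓ b} sq ↦ ?_⟩
  have sq' : CommSq (ℓ ≫ mappingComplexMap g Z) (SSet.boundary.{v} n).ι (mappingComplexPost A p)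
      (b ≫ mappingComplexMap g Y) :=
    ⟨by rw [Category.assoc, ← mappingComplex_comm, reassoc_of% sq.w]⟩
  obtain ⟨c, hc₁, hc₂, hc₃⟩ := h₂ ℓ sq'.lift b sq'.fac_left sq.w.symm sq'.fac_right.symm
  exact ⟨⟨{ l := c, fac_left := hc₁, fac_right := hc₃ }⟩⟩

/-- A map to the mapping complex out of a pushout is a pair of compatible maps. -/
lemma exists_desc_mappingComplex {P : CosimplicialObject M} {f : A ⟶ B} {g : A ⟶ D} {i : B ⟶ P}
    {j : D ⟶ P} (sq : IsPushout f g i j) [HasFiniteColimits M] {K : SSet.{v}} {Z : M}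
    (a : K ⟶ mappingComplex B Z) (b : K ⟶ mappingComplex D Z)
    (h : a ≫ mappingComplexMap f Z = b ≫ mappingComplexMap g Z) :
    ∃ c : K ⟶ mappingComplex P Z, c ≫ mappingComplexMap i Z = a ∧
      c ≫ mappingComplexMap j Z = b := by
  have sq' (n : SimplexCategory) := sq.map ((evaluation _ M).obj n)
  have hab (k : SimplexCategoryᵒᵖ) (x : K.obj k) :
      f.app k.unop ≫ (show B.obj k.unop ⟶ Z from a.app k x) =
        g.app k.unop ≫ (show D.obj k.unop ⟶ Z from b.app k x) :=
    ConcreteCategory.congr_hom (NatTrans.congr_app h k) x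
  refine ⟨{ app := fun k ↦ ↾fun x ↦ (sq' k.unop).desc (a.app k x) (b.app k x) (hab k x)
            naturality := fun k l α ↦ ?_ }, ?_, ?_⟩
  · ext x
    refine (sq' l.unop).hom_ext ?_ ?_
    · refine ((sq' l.unop).inl_desc _ _ _).trans ((NatTrans.naturality_apply a α x).trans ?_)
      refine Eq.trans ?_ (NatTrans.naturality_assoc i α.unop _)
      exact congr_arg (B.map α.unop ≫ ·) ((sq' k.unop).inl_desc _ _ _).symm
    · refine ((sq' l.unop).inr_desc _ _ _).trans ((NatTrans.naturality_apply b α x).trans ?_)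
      refine Eq.trans ?_ (NatTrans.naturality_assoc j α.unop _)
      exact congr_arg (D.map α.unop ≫ ·) ((sq' k.unop).inr_desc _ _ _).symm
  · ext k x
    exact (sq' k.unop).inl_desc _ _ _
  · ext k x
    exact (sq' k.unop).inr_desc _ _ _

lemma mappingComplex_hom_ext {P : CosimplicialObject M} {f : A ⟶ B} {g : A ⟶ D} {i : B ⟶ P}
    {j : D ⟶ P} (sq : IsPushout f g i j) [HasFiniteColimits M] {K : SSet.{v}} {Z : M}
    {a b : K ⟶ mappingComplex P Z}
    (h₁ : a ≫ mappingComplexMap i Z = b ≫ mappingComplexMap i Z)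
    (h₂ : a ≫ mappingComplexMap j Z = b ≫ mappingComplexMap j Z) : a = b := by
  ext k x
  exact (sq.map ((evaluation _ _).obj k.unop)).hom_ext
    (ConcreteCategory.congr_hom (NatTrans.congr_app h₁ k) x)
    (ConcreteCategory.congr_hom (NatTrans.congr_app h₂ k) x)

lemma ReedyCofibration.of_isPushout {P : CosimplicialObject M} {f : A ⟶ B} {g : A ⟶ D}
    {i : B ⟶ P} {j : D ⟶ P} (sq : IsPushout f g i j) (hg : ReedyCofibration S g) :
    ReedyCofibration S i := by
  let := S
  intro n Z Y p hp hp'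
  have h₁ := hg n p hp hp'
  rw [hasLiftingProperty_leibnizHom_iff] at h₁ ⊢
  intro ℓ a b hℓa hℓb hab
  obtain ⟨c, hc₁, hc₂, hc₃⟩ := h₁ (ℓ ≫ mappingComplexMap j Z) (a ≫ mappingComplexMap f Z)
    (b ≫ mappingComplexMap j Y)
    (by rw [reassoc_of% hℓa, Category.assoc, ← mappingComplexMap_comp, ← mappingComplexMap_comp,
      sq.w])
    (by rw [reassoc_of% hℓb, Category.assoc, mappingComplex_comm])
    (by rw [Category.assoc, Category.assoc, ← mappingComplex_comm, ← reassoc_of% hab,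
      ← mappingComplexMap_comp, ← mappingComplexMap_comp, sq.w])
  obtain ⟨d, hd₁, hd₂⟩ := exists_desc_mappingComplex sq a c hc₂.symm
  refine ⟨d, mappingComplex_hom_ext sq ?_ ?_, hd₁, mappingComplex_hom_ext sq ?_ ?_⟩
  · rw [Category.assoc, hd₁, hℓa]
  · rw [Category.assoc, hd₂, hc₁]
  · rw [Category.assoc, mappingComplex_comm, reassoc_of% hd₁, hab]
  · rw [Category.assoc, mappingComplex_comm, reassoc_of% hd₂, hc₃]

lemma mappingComplex_initial_hom_ext [HasFiniteColimits M] {O : CosimplicialObject M}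
    (hO : IsInitial O) {K : SSet.{v}} {Z : M} (a b : K ⟶ mappingComplex O Z) : a = b := by
  ext n x
  exact (IsInitial.isInitialObj ((evaluation _ _).obj n.unop) _ hO).hom_ext _ _

lemma reedyCofibration_of_isInitial {O : CosimplicialObject M} (hO : IsInitial O)
    (hA : ReedyCofibrant S A) : ReedyCofibration S (hO.to A) := by
  let := S
  rw [reedyCofibrant_iff] at hA
  intro n Z Y p hp hp'
  have := hA n p hp hp'
  rw [hasLiftingProperty_leibnizHom_iff]
  intro ℓ a b h₁ h₂ h₃
  have sq : CommSq ℓ (SSet.boundary.{v} n).ι (mappingComplexPost A p) b := ⟨h₂.symm⟩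
  exact ⟨sq.lift, sq.fac_left, mappingComplex_initial_hom_ext hO _ _, sq.fac_right⟩

/-! ### Reedy trivial cofibrations -/

/-- A lifting property against the boundary inclusions of dimension `< n` yields a lifting property
against `∅ ⟶ ∂Δ[n]`, because `∂Δ[n]` is built from cells of dimension `< n`. -/
lemma hasLiftingProperty_bot_boundary {X Y : SSet.{v}} (f : X ⟶ Y) (n : ℕ)
    (h : ∀ k < n, HasLiftingProperty (SSet.boundary.{v} k).ι f) :
    HasLiftingProperty (⊥ : (SSet.boundary.{v} n : SSet.{v}).Subcomplex).ι f := by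
  let J : MorphismProperty SSet.{v} :=
    MorphismProperty.ofHoms (fun k : Fin n ↦ (SSet.boundary.{v} k).ι)
  have hJ : J.rlp f := by
    rintro _ _ _ ⟨k⟩
    exact h k k.2
  refine MorphismProperty.transfiniteCompositionsOfShape_pushouts_coproducts_le_llp_rlp.{v} J ℕ _
    ⟨(SSet.relativeCellComplex (SSet.boundary.{v} n : SSet.{v})).transfiniteCompositionOfShape'
      (fun c ↦ ?_)⟩ f hJ
  have : c.j < n := SSet.dim_lt_of_nonDegenerate _ ⟨c.k.simplex, c.k.nonDegenerate⟩ n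
  exact ⟨(⟨c.j, this⟩ : Fin n)⟩

/-- If a Reedy cofibration is a levelwise weak equivalence, its relative latching maps are trivial
cofibrations. The induction on `n` shows that `L_n A ⟶ L_n B` is a trivial cofibration as well. -/
lemma ReedyCofibration.hasLiftingProperty {g : A ⟶ B} (hg : ReedyCofibration S g)
    (hw : ∀ n, W S (g.app n)) (n : ℕ) {Z Y : M} (p : Z ⟶ Y) (hp : Fib S p) :
    HasLiftingProperty (SSet.boundary.{v} n).ι (leibnizHom g p) := by
  let := S
  induction n using Nat.strong_induction_on generalizing Z Y with | _ n ih
  have hL : Cof S (latchingObjMap g n) ∧ W S (latchingObjMap g n) := by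
    rw [trivialCof_iff]
    intro Z Y p hp
    have := hasLiftingProperty_bot_boundary (leibnizHom g p) n fun k hk ↦ ih k hk p hp
    rw [hasLiftingProperty_leibnizHom_iff] at this
    refine ⟨fun {a b} sq ↦ ?_⟩
    obtain ⟨c, -, hc₁, hc₂⟩ := this (SSet.Subcomplex.isInitialBot.to _)
      ((boundaryEquiv A n Z).symm a) ((boundaryEquiv B n Y).symm b)
      (SSet.Subcomplex.isInitialBot.hom_ext _ _) (SSet.Subcomplex.isInitialBot.hom_ext _ _)
      ((boundaryEquiv A n Y).injective (by
        rw [boundaryEquiv_comp_map, boundaryEquiv_comp_post, Equiv.apply_symm_apply,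
          Equiv.apply_symm_apply, sq.w]))
    refine ⟨⟨{ l := boundaryEquiv B n Z c, fac_left := ?_, fac_right := ?_ }⟩⟩
    · rw [← boundaryEquiv_comp_map, hc₁, Equiv.apply_symm_apply]
    · rw [← boundaryEquiv_comp_post, hc₂, Equiv.apply_symm_apply]
  have hinr : W S (pushout.inr (latchingObjMap g n) (latchingMap A n)) :=
    ((trivialCofibrations M).of_isPushout
      (IsPushout.of_hasPushout (latchingObjMap g n) (latchingMap A n)).flip hL).2
  have hrel : W S (relativeLatchingMap g n) := by
    refine (W S).of_precomp _ _ hinr ?_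
    rw [relativeLatchingMap, pushout.inr_desc]
    exact hw _
  rw [hasLiftingProperty_boundary_leibnizHom_iff]
  exact (trivialCof_iff S _).mp ⟨(reedyCofibration_iff S g).mp hg n, hrel⟩ p hp

/-- A Reedy cofibration which is a levelwise weak equivalence induces trivial Kan fibrations on
mapping complexes to fibrant objects. -/
lemma ReedyCofibration.isWeakEquivalence {g : A ⟶ B} (hg : ReedyCofibration S g)
    (hw : ∀ n, W S (g.app n)) {X : M} (hX : Fibrant S X) :
    SimplicialSets.IsWeakEquivalence (mappingComplexMap g X) := by
  let := S
  refine SimplicialSets.IsWeakEquivalence.of_rlp_boundary ((rlp_I_iff _).mpr fun n ↦ ?_)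
  have := hg.hasLiftingProperty hw n (terminal.from X) ((HomotopicalAlgebra.fibration_iff _).mp hX)
  rw [hasLiftingProperty_leibnizHom_iff] at this
  have terminal_ext (C : CosimplicialObject M) {K : SSet.{v}} (a b : K ⟶ mappingComplex C (⊤_ M)) :
      a = b := by
    ext k x
    exact terminal.hom_ext _ _
  refine ⟨fun {ℓ a} sq ↦ ?_⟩
  obtain ⟨c, hc₁, hc₂, -⟩ := this ℓ a ((simplexEquiv B n (⊤_ M)).symm (terminal.from _)) sq.w.symm
    (terminal_ext _ _ _) (terminal_ext _ _ _)
  exact ⟨⟨{ l := c, fac_left := hc₁, fac_right := hc₂ }⟩⟩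

end

end ModelStructure

/-! ### Powers of an object by a levelwise finite simplicial set -/

namespace Reedy

open ModelStructure

section

variable {M : Type u} [Category.{v} M] [HasFiniteProducts M]

instance finite_stdSimplex (n : ℕ) (k : SimplexCategoryᵒᵖ) : Finite ((Δ[n] : SSet.{v}).obj k) :=
  Finite.of_equiv _ SSet.stdSimplex.objEquiv.symm

instance finite_boundary (n : ℕ) (k : SimplexCategoryᵒᵖ) :
    Finite ((SSet.boundary.{v} n : SSet.{v}).obj k) :=
  inferInstanceAs (Finite ((SSet.boundary.{v} n).obj k))

/-- The cosimplicial object `m ↦ ∏_{S_m} Z`. Maps `Y ⟶ power S Z` are the same as maps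
`S ⟶ M(Y, Z)`. -/
noncomputable def power (S : SSet.{v}) [∀ k, Finite (S.obj k)] (Z : M) : CosimplicialObject M where
  obj m := ∏ᶜ fun (_ : S.obj (.op m)) ↦ Z
  map α := Pi.lift fun x ↦ Pi.π _ (S.map α.op x)
  map_id m := by
    refine Pi.hom_ext _ _ fun x ↦ (Pi.lift_π _ _).trans ?_
    refine Eq.trans ?_ (Category.id_comp _).symm
    exact congr_arg (Pi.π (fun (_ : S.obj (.op m)) ↦ Z)) (S.map_id_apply _ x)
  map_comp {k l m} α β := by
    refine Pi.hom_ext _ _ fun x ↦ (Pi.lift_π _ _).trans ?_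
    rw [Category.assoc, Pi.lift_π, Pi.lift_π]
    exact congr_arg (Pi.π (fun (_ : S.obj (.op k)) ↦ Z)) (S.map_comp_apply β.op α.op x)

variable {S : SSet.{v}} [∀ k, Finite (S.obj k)] {Z : M}

/-- The projection from a power. -/
noncomputable def powerπ {m : SimplexCategory} (x : S.obj (.op m)) : (power S Z).obj m ⟶ Z :=
  Pi.π (fun (_ : S.obj (.op m)) ↦ Z) x

lemma power_hom_ext {m : SimplexCategory} {T : M} {a b : T ⟶ (power S Z).obj m}
    (h : ∀ x : S.obj (.op m), a ≫ powerπ x = b ≫ powerπ x) : a = b :=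
  Pi.hom_ext _ _ h

lemma power_map_π {m k : SimplexCategory} (α : m ⟶ k) (x : S.obj (.op k)) :
    (power S Z).map α ≫ powerπ x = powerπ (S.map α.op x) :=
  Pi.lift_π _ _

/-- The map to a power given by a map to a mapping complex. -/
noncomputable def toPower {Y : CosimplicialObject M} (s : S ⟶ mappingComplex Y Z) :
    Y ⟶ power S Z where
  app m := Pi.lift fun x ↦ s.app (.op m) x
  naturality m k α := by
    refine power_hom_ext fun x ↦ (Category.assoc _ _ _).trans ?_
    refine (congr_arg (_ ≫ ·) (Pi.lift_π _ _)).trans ?_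
    refine Eq.trans ?_ (Category.assoc _ _ _).symm
    refine Eq.trans ?_ (congr_arg (_ ≫ ·) (power_map_π α x).symm)
    refine Eq.trans ?_ (Pi.lift_π (fun x ↦ s.app (.op m) x) (S.map α.op x)).symm
    exact (NatTrans.naturality_apply s α.op x).symm

lemma toPower_π {Y : CosimplicialObject M} (s : S ⟶ mappingComplex Y Z) {m : SimplexCategory}
    (x : S.obj (.op m)) :
    (toPower s).app m ≫ powerπ x = s.app (.op m) x :=
  Pi.lift_π _ _

/-- The universal element of `M(power S Z, Z)`. -/
noncomputable def powerEval (S : SSet.{v}) [∀ k, Finite (S.obj k)] (Z : M) :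
    S ⟶ mappingComplex (power S Z) Z where
  app m := ↾fun x ↦ powerπ x
  naturality m k α := by
    ext x
    exact (power_map_π α.unop x).symm

end

end Reedy

namespace Reedy

open ModelStructure

variable {M : Type u} [Category.{v} M] [HasFiniteProducts M]

/-- The projection of `power Δ[n] Z` to `Z` given by a map `⦋m⦌ ⟶ ⦋n⦌`. -/
noncomputable def simplexPowerπ (Z : M) {n : ℕ} {m : SimplexCategory} (α : m ⟶ ⦋n⦌) :
    (power Δ[n] Z).obj m ⟶ Z :=
  powerπ (SSet.stdSimplex.objEquiv.symm α)

lemma simplexPower_hom_ext {Z : M} {n : ℕ} {m : SimplexCategory} {T : M}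
    {a b : T ⟶ (power Δ[n] Z).obj m}
    (h : ∀ α : m ⟶ ⦋n⦌, a ≫ simplexPowerπ Z α = b ≫ simplexPowerπ Z α) : a = b :=
  power_hom_ext fun x ↦ h (SSet.stdSimplex.objEquiv x)

end Reedy

/-! ### Replacing one degree of a cosimplicial object -/

namespace Reedy

open ModelStructure

variable {M : Type u} [Category.{v} M]

lemma simplexEquiv_symm_app {Y : CosimplicialObject M} {n : ℕ} {Z : M} (e : Y.obj ⦋n⦌ ⟶ Z)
    {m : SimplexCategory} (α : m ⟶ ⦋n⦌) :
    ((simplexEquiv Y n Z).symm e).app (.op m) (SSet.stdSimplex.objEquiv.symm α) = Y.map α ≫ e :=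
  rfl

variable [HasFiniteLimits M] [HasFiniteColimits M]

instance hasBinaryProducts : HasBinaryProducts (CosimplicialObject M) :=
  inferInstanceAs (HasBinaryProducts (_ ⥤ _))

instance hasPullbacks : HasPullbacks (CosimplicialObject M) :=
  inferInstanceAs (HasPullbacks (_ ⥤ _))

section
variable {Y : CosimplicialObject M} {n : ℕ} {X : M} (q : X ⟶ Y.obj ⦋n⦌) (ℓ : latchingObj Y n ⟶ X)

/-- The map `Y ⟶ (Y^n)^{Δ[n]} × X^{∂Δ[n]}`. -/
noncomputable def attachBase :
    Y ⟶ power Δ[n] (Y.obj ⦋n⦌) ⨯ power (SSet.boundary.{v} n : SSet.{v}) X :=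
  prod.lift (toPower ((simplexEquiv Y n _).symm (𝟙 _))) (toPower ((boundaryEquiv Y n X).symm ℓ))

/-- The map `X^{Δ[n]} ⟶ (Y^n)^{Δ[n]} × X^{∂Δ[n]}`. -/
noncomputable def attachRestr :
    power Δ[n] X ⟶ power Δ[n] (Y.obj ⦋n⦌) ⨯ power (SSet.boundary.{v} n : SSet.{v}) X :=
  prod.lift (toPower (powerEval Δ[n] X ≫ mappingComplexPost _ q))
    (toPower ((SSet.boundary.{v} n).ι ≫ powerEval Δ[n] X))

/-- For a factorization `L_n Y ⟶ X ⟶ Y^n` of the latching map, the cosimplicial object obtained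
from `Y` by putting `X` in degree `n`. A map `T ⟶ (attach q ℓ)^m` consists of a map `T ⟶ Y^m` and of
lifts `T ⟶ X` of its composites with the maps `Y^m ⟶ Y^n` given by all `α : ⦋m⦌ ⟶ ⦋n⦌`, where the
lift is the one prescribed by `L_n Y ⟶ X` whenever `α` is not surjective. -/
noncomputable def attach : CosimplicialObject M :=
  pullback (attachBase ℓ) (attachRestr q)

/-- The projection `attach q ℓ ⟶ Y`. -/
noncomputable def attachFst : attach q ℓ ⟶ Y := pullback.fst _ _

/-- The projection of `attach q ℓ` to `X` given by `α : ⦋m⦌ ⟶ ⦋n⦌`. -/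
noncomputable def attachπ {m : SimplexCategory} (α : m ⟶ ⦋n⦌) : (attach q ℓ).obj m ⟶ X :=
  NatTrans.app (pullback.snd (attachBase ℓ) (attachRestr q)) m ≫ simplexPowerπ X α

variable {q ℓ}
lemma attach_hom_ext {m : SimplexCategory} {T : M} {a b : T ⟶ (attach q ℓ).obj m}
    (h₁ : a ≫ (attachFst q ℓ).app m = b ≫ (attachFst q ℓ).app m)
    (h₂ : ∀ α, a ≫ attachπ q ℓ α = b ≫ attachπ q ℓ α) : a = b := by
  refine ((IsPullback.of_hasPullback (attachBase ℓ) (attachRestr q)).map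
    ((evaluation _ _).obj m)).hom_ext h₁ (simplexPower_hom_ext fun α ↦ ?_)
  exact (Category.assoc _ _ _).trans ((h₂ α).trans (Category.assoc _ _ _).symm)

lemma map_attachπ {m k : SimplexCategory} (β : k ⟶ m) (α : m ⟶ ⦋n⦌) :
    (attach q ℓ).map β ≫ attachπ q ℓ α = attachπ q ℓ (β ≫ α) := by
  refine (NatTrans.naturality_assoc (pullback.snd (attachBase ℓ) (attachRestr q)) β _).trans ?_
  exact congr_arg (_ ≫ ·) (power_map_π β _)

/-- The two conditions which describe maps to the pullback `attach q ℓ` in degree `m`. -/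
lemma attach_compatible {m : SimplexCategory} {T : M} (y : T ⟶ Y.obj m)
    (x : T ⟶ (power Δ[n] X).obj m) :
    y ≫ (attachBase ℓ).app m = x ≫ (attachRestr q).app m ↔
      (∀ α : m ⟶ ⦋n⦌, y ≫ Y.map α = x ≫ simplexPowerπ X α ≫ q) ∧
      ∀ (α : m ⟶ ⦋n⦌) (hα : ¬ Function.Surjective α.toOrderHom),
        y ≫ latchingη Y α hα ≫ ℓ = x ≫ simplexPowerπ X α := by
  let P₁ := power Δ[n] (Y.obj ⦋n⦌)
  let P₂ := power (SSet.boundary.{v} n : SSet.{v}) X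
  have hl := isLimitOfHasBinaryProductOfPreservesLimit ((evaluation SimplexCategory M).obj m) P₁ P₂
  have ext {a b : T ⟶ (P₁ ⨯ P₂).obj m} : a = b ↔ a ≫ NatTrans.app (prod.fst : P₁ ⨯ P₂ ⟶ P₁) m =
    b ≫ NatTrans.app (prod.fst : P₁ ⨯ P₂ ⟶ P₁) m ∧ a ≫ NatTrans.app (prod.snd : P₁ ⨯ P₂ ⟶ P₂) m =
    b ≫ NatTrans.app (prod.snd : P₁ ⨯ P₂ ⟶ P₂) m :=
    ⟨by rintro rfl; exact ⟨rfl, rfl⟩, fun h ↦ BinaryFan.IsLimit.hom_ext hl h.1 h.2⟩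
  have e₁ : (attachBase ℓ).app m ≫ NatTrans.app (prod.fst : P₁ ⨯ P₂ ⟶ P₁) m =
      (toPower ((simplexEquiv Y n _).symm (𝟙 _))).app m := NatTrans.congr_app (prod.lift_fst _ _) m
  have e₂ : (attachBase ℓ).app m ≫ NatTrans.app (prod.snd : P₁ ⨯ P₂ ⟶ P₂) m =
      (toPower ((boundaryEquiv Y n X).symm ℓ)).app m := NatTrans.congr_app (prod.lift_snd _ _) m
  have e₃ : (attachRestr q).app m ≫ NatTrans.app (prod.fst : P₁ ⨯ P₂ ⟶ P₁) m =
      (toPower (powerEval Δ[n] X ≫ mappingComplexPost _ q)).app m :=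
    NatTrans.congr_app (prod.lift_fst _ _) m
  have e₄ : (attachRestr q).app m ≫ NatTrans.app (prod.snd : P₁ ⨯ P₂ ⟶ P₂) m =
      (toPower ((SSet.boundary.{v} n).ι ≫ powerEval Δ[n] X)).app m :=
    NatTrans.congr_app (prod.lift_snd _ _) m
  rw [ext]
  refine and_congr ?_ ?_
  · have h₁ (α : m ⟶ ⦋n⦌) : (y ≫ (attachBase ℓ).app m ≫ NatTrans.app (prod.fst : P₁ ⨯ P₂ ⟶ P₁) m) ≫
        simplexPowerπ _ α = y ≫ Y.map α := by
      rw [Category.assoc]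
      refine congr_arg (y ≫ ·) ((congr_arg (· ≫ _) e₁).trans ((toPower_π _ _).trans ?_))
      exact simplexEquiv_symm_app _ _ |>.trans (Category.comp_id _)
    have h₂ (α : m ⟶ ⦋n⦌) : (x ≫ (attachRestr q).app m ≫ NatTrans.app (prod.fst : P₁ ⨯ P₂ ⟶ P₁) m) ≫
        simplexPowerπ _ α = x ≫ simplexPowerπ X α ≫ q := by
      rw [Category.assoc]
      exact congr_arg (x ≫ ·) ((congr_arg (· ≫ _) e₃).trans (toPower_π _ _))
    rw [Category.assoc, Category.assoc]
    exact ⟨fun h α ↦ (h₁ α).symm.trans ((congr_arg (· ≫ _) h).trans (h₂ α)),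
      fun h ↦ simplexPower_hom_ext fun α ↦ (h₁ α).trans ((h α).trans (h₂ α).symm)⟩
  · have h₁ (α : m ⟶ ⦋n⦌) (hα : ¬ Function.Surjective α.toOrderHom) :
        (y ≫ (attachBase ℓ).app m ≫ NatTrans.app (prod.snd : P₁ ⨯ P₂ ⟶ P₂) m) ≫
        powerπ (S := (SSet.boundary.{v} n : SSet.{v})) ⟨SSet.stdSimplex.objEquiv.symm α, hα⟩ =
          y ≫ latchingη Y α hα ≫ ℓ := by
      rw [Category.assoc]
      exact congr_arg (y ≫ ·) ((congr_arg (· ≫ _) e₂).trans (toPower_π _ _))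
    have h₂ (α : m ⟶ ⦋n⦌) (hα : ¬ Function.Surjective α.toOrderHom) :
        (x ≫ (attachRestr q).app m ≫ NatTrans.app (prod.snd : P₁ ⨯ P₂ ⟶ P₂) m) ≫
        powerπ (S := (SSet.boundary.{v} n : SSet.{v})) ⟨SSet.stdSimplex.objEquiv.symm α, hα⟩ =
          x ≫ simplexPowerπ X α := by
      rw [Category.assoc]
      exact congr_arg (x ≫ ·) ((congr_arg (· ≫ _) e₄).trans (toPower_π _ _))
    rw [Category.assoc, Category.assoc]
    exact ⟨fun h α hα ↦ (h₁ α hα).symm.trans ((congr_arg (· ≫ _) h).trans (h₂ α hα)),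
      fun h ↦ power_hom_ext fun α ↦ (h₁ (SSet.stdSimplex.objEquiv α.1) α.2).trans
        ((h _ _).trans (h₂ (SSet.stdSimplex.objEquiv α.1) α.2).symm)⟩

lemma attachFst_map {m : SimplexCategory} (α : m ⟶ ⦋n⦌) :
    (attachFst q ℓ).app m ≫ Y.map α = attachπ q ℓ α ≫ q := by
  refine (((attach_compatible _ _).mp (NatTrans.congr_app
    (pullback.condition (f := attachBase ℓ) (g := attachRestr q)) m)).1 α).trans ?_
  exact (Category.assoc _ _ _).symm

lemma attachFst_latchingη {m : SimplexCategory} (α : m ⟶ ⦋n⦌)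
    (hα : ¬ Function.Surjective α.toOrderHom) :
    (attachFst q ℓ).app m ≫ latchingη Y α hα ≫ ℓ = attachπ q ℓ α :=
  ((attach_compatible _ _).mp
    (NatTrans.congr_app (pullback.condition (f := attachBase ℓ) (g := attachRestr q)) m)).2 α hα

/-- The universal property of `attach q ℓ` in degree `m`. -/
lemma exists_lift_attach_app {m : SimplexCategory} {T : M} (y : T ⟶ Y.obj m)
    (x : (m ⟶ ⦋n⦌) → (T ⟶ X)) (h₁ : ∀ α, y ≫ Y.map α = x α ≫ q)
    (h₂ : ∀ (α : m ⟶ ⦋n⦌) (hα : ¬ Function.Surjective α.toOrderHom),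
      y ≫ latchingη Y α hα ≫ ℓ = x α) :
    ∃ t : T ⟶ (attach q ℓ).obj m, t ≫ (attachFst q ℓ).app m = y ∧
      ∀ α, t ≫ attachπ q ℓ α = x α := by
  let x' : T ⟶ (power Δ[n] X).obj m := Pi.lift fun s ↦ x (SSet.stdSimplex.objEquiv s)
  have hx' (α : m ⟶ ⦋n⦌) : x' ≫ simplexPowerπ X α = x α :=
    (Pi.lift_π (fun s ↦ x (SSet.stdSimplex.objEquiv s)) _).trans
      (congr_arg x (Equiv.apply_symm_apply _ _))
  have sq := (IsPullback.of_hasPullback (attachBase ℓ) (attachRestr q)).map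
    ((evaluation SimplexCategory M).obj m)
  have h : y ≫ (attachBase ℓ).app m = x' ≫ (attachRestr q).app m := by
    refine (attach_compatible _ _).mpr ⟨fun α ↦ ?_, fun α hα ↦ ?_⟩
    · rw [h₁, ← hx', Category.assoc]
    · rw [h₂, hx']
  refine ⟨sq.lift y x' h, sq.lift_fst _ _ _, fun α ↦ (Category.assoc _ _ _).symm.trans ?_⟩
  exact (congr_arg (· ≫ _) (sq.lift_snd _ _ _)).trans (hx' α)

/-- A map of cosimplicial objects to `attach q ℓ` is determined by a map to `Y` and a map to `X` in
degree `n`. -/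
lemma exists_lift_attach {E : CosimplicialObject M} (h : E ⟶ Y) (e : E.obj ⦋n⦌ ⟶ X)
    (h₁ : e ≫ q = h.app ⦋n⦌) (h₂ : latchingMap E n ≫ e = latchingObjMap h n ≫ ℓ) :
    ∃ t : E ⟶ attach q ℓ, t ≫ attachFst q ℓ = h ∧
      ∀ (m : SimplexCategory) (α : m ⟶ ⦋n⦌), t.app m ≫ attachπ q ℓ α = E.map α ≫ e := by
  let x := toPower ((simplexEquiv E n X).symm e)
  have hx (m : SimplexCategory) (α : m ⟶ ⦋n⦌) : x.app m ≫ simplexPowerπ X α = E.map α ≫ e :=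
    (toPower_π _ _).trans (simplexEquiv_symm_app _ _)
  have w : h ≫ attachBase ℓ = x ≫ attachRestr q := by
    refine NatTrans.ext (funext fun m ↦ ?_)
    refine (attach_compatible (h.app m) (x.app m)).mpr ⟨fun α ↦ ?_, fun α hα ↦ ?_⟩
    · refine (NatTrans.naturality h α).symm.trans ?_
      refine Eq.trans ?_ (Category.assoc _ _ _)
      refine Eq.trans ?_ (congr_arg (· ≫ q) (hx m α).symm)
      refine Eq.trans ?_ (Category.assoc _ _ _).symm
      rw [h₁]
    · refine Eq.trans ?_ (hx m α).symm
      rw [← Category.assoc, ← latchingη_latchingObjMap, Category.assoc, ← h₂,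
        ← Category.assoc, latchingη_latchingMap]
  refine ⟨pullback.lift h x w, pullback.lift_fst _ _ _, fun m α ↦ ?_⟩
  refine (Category.assoc _ _ _).symm.trans (Eq.trans ?_ (hx m α))
  exact congr_arg (· ≫ _) (NatTrans.congr_app (pullback.lift_snd _ _ w) m)

/-- In each degree, `attach q ℓ ⟶ Y` is a base change of a product of copies of `q`: a lift is free
to be chosen in the coordinates given by surjective maps. -/
lemma hasLiftingProperty_attachFst {U V : M} (i : U ⟶ V) [HasLiftingProperty i q]
    (hℓ : ℓ ≫ q = latchingMap Y n) (m : SimplexCategory) :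
    HasLiftingProperty i ((attachFst q ℓ).app m) := by
  classical
  refine ⟨fun {u b} sq ↦ ?_⟩
  have sq' (α : m ⟶ ⦋n⦌) : CommSq (u ≫ attachπ q ℓ α) i q (b ≫ Y.map α) :=
    ⟨by rw [Category.assoc, ← attachFst_map, ← Category.assoc, sq.w, Category.assoc]⟩
  obtain ⟨t, ht₁, ht₂⟩ := exists_lift_attach_app (q := q) (ℓ := ℓ) b
    (fun α ↦ if hα : Function.Surjective α.toOrderHom then (sq' α).lift else
      b ≫ latchingη Y α hα ≫ ℓ)
    (fun α ↦ by
      split_ifs with hα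
      · exact (sq' α).fac_right.symm
      · rw [Category.assoc, Category.assoc, hℓ, latchingη_latchingMap])
    (fun α hα ↦ by rw [dif_neg hα])
  refine ⟨⟨{ l := t, fac_left := ?_, fac_right := ht₁ }⟩⟩
  refine attach_hom_ext (by rw [Category.assoc, ht₁, sq.w]) fun α ↦ ?_
  rw [Category.assoc, ht₂]
  split_ifs with hα
  · exact (sq' α).fac_left
  · rw [← Category.assoc, ← sq.w, Category.assoc, attachFst_latchingη]

lemma isIso_attachFst_app (hℓ : ℓ ≫ q = latchingMap Y n) (m : SimplexCategory) (hm : m.len < n) :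
    IsIso ((attachFst q ℓ).app m) := by
  obtain ⟨t, ht₁, ht₂⟩ := exists_lift_attach_app (q := q) (ℓ := ℓ) (𝟙 (Y.obj m))
    (fun α ↦ latchingη Y α (not_surjective_of_lt α hm) ≫ ℓ)
    (fun α ↦ by rw [Category.assoc, hℓ, latchingη_latchingMap, Category.id_comp])
    (fun α hα ↦ Category.id_comp _)
  refine ⟨t, attach_hom_ext ?_ fun α ↦ ?_, ht₁⟩
  · rw [Category.assoc, ht₁, Category.id_comp, Category.comp_id]
  · rw [Category.assoc, ht₂, attachFst_latchingη, Category.id_comp]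

lemma isIso_attachπ_id (hℓ : ℓ ≫ q = latchingMap Y n) : IsIso (attachπ q ℓ (𝟙 ⦋n⦌)) := by
  classical
  have key (α : (⦋n⦌ : SimplexCategory) ⟶ ⦋n⦌) (hα : Function.Surjective α.toOrderHom) :
      α = 𝟙 _ := by
    rw [← SimplexCategory.epi_iff_surjective] at hα
    exact SimplexCategory.eq_id_of_epi α
  obtain ⟨t, ht₁, ht₂⟩ := exists_lift_attach_app (q := q) (ℓ := ℓ) q
    (fun α ↦ if hα : Function.Surjective α.toOrderHom then 𝟙 X else q ≫ latchingη Y α hα ≫ ℓ)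
    (fun α ↦ by
      split_ifs with hα
      · rw [key α hα]
        exact (congr_arg (q ≫ ·) (Y.map_id _)).trans
          ((Category.comp_id _).trans (Category.id_comp _).symm)
      · rw [Category.assoc, Category.assoc, hℓ, latchingη_latchingMap])
    (fun α hα ↦ by rw [dif_neg hα])
  have hid : Function.Surjective (SimplexCategory.Hom.toOrderHom (𝟙 ⦋n⦌)) := Function.surjective_id
  have hq : attachπ q ℓ (𝟙 ⦋n⦌) ≫ q = (attachFst q ℓ).app ⦋n⦌ := by
    rw [← attachFst_map]
    exact (congr_arg (_ ≫ ·) (Y.map_id _)).trans (Category.comp_id _)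
  refine ⟨t, attach_hom_ext ?_ fun α ↦ ?_, ?_⟩
  · rw [Category.assoc, ht₁, hq, Category.id_comp]
  · rw [Category.assoc, ht₂, Category.id_comp]
    split_ifs with hα
    · rw [key α hα, Category.comp_id]
    · rw [← Category.assoc, hq, attachFst_latchingη]
  · rw [ht₂, dif_pos hid]

end

end Reedy

/-! ### Reedy factorizations -/

namespace Reedy

variable {M : Type u} [Category.{v} M] [HasFiniteColimits M]

lemma isIso_latchingObjMap {A B : CosimplicialObject M} (g : A ⟶ B) (n : ℕ)
    (h : ∀ d : SimplexCategory, d.len < n → IsIso (g.app d)) : IsIso (latchingObjMap g n) := by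
  have : IsIso (Functor.whiskerLeft (inducedFunctor (LatchingIndex.toOver (n := n)) ⋙
      Over.forget _) g) := by
    rw [NatTrans.isIso_iff_isIso_app]
    exact fun x ↦ h _ x.1.2
  exact (HasColimit.isoOfNatIso (asIso (Functor.whiskerLeft (inducedFunctor
    (LatchingIndex.toOver (n := n)) ⋙ Over.forget _) g))).isIso_hom

end Reedy

namespace ModelStructure

open Reedy

/-- A multiplicative class of maps that contains the steps of a tower from stage `j` on contains all
the maps to stage `j`. -/
lemma ofOpSequence_map_mem {C : Type u} [Category.{v} C] (P : MorphismProperty C)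
    [P.IsMultiplicative] {X : ℕ → C} (φ : ∀ n, X (n + 1) ⟶ X n) {j : ℕ}
    (h : ∀ n, j ≤ n → P (φ n)) {i : ℕ} (hij : j ≤ i) :
    P ((Functor.ofOpSequence φ).map (homOfLE hij).op) := by
  induction i, hij using Nat.le_induction with
  | base =>
    have : (homOfLE (le_refl j)).op = 𝟙 (Opposite.op j) := rfl
    rw [this, CategoryTheory.Functor.map_id]
    exact P.id_mem _
  | succ i hi ih =>
    have : (homOfLE (hi.trans i.le_succ)).op = (homOfLE i.le_succ).op ≫ (homOfLE hi).op := rfl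
    rw [this, CategoryTheory.Functor.map_comp]
    refine P.comp_mem _ _ ?_ ih
    have := Functor.ofOpSequence_map_homOfLE_succ φ i
    exact this ▸ h i hi

variable {M : Type u} [Category.{v} M] (S : ModelCategory M)

/-- A relative latching map is a cofibration if it is isomorphic to a map
`E^n ⊔_{L_n E} V ⟶ X` which is one. -/
lemma cof_relativeLatchingMap_of_isIso [HasFiniteColimits M] {E D : CosimplicialObject M}
    (g : E ⟶ D) {n : ℕ} {V X : M} (lat : latchingObj D n ⟶ V) [IsIso lat]
    (c : D.obj ⦋n⦌ ⟶ X) [IsIso c] (ℓ : V ⟶ X) (e : E.obj ⦋n⦌ ⟶ X)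
    (k : latchingObj E n ⟶ V) (hk : latchingObjMap g n ≫ lat = k)
    (hℓ : lat ≫ ℓ = latchingMap D n ≫ c) (he : g.app ⦋n⦌ ≫ c = e)
    (w : k ≫ ℓ = latchingMap E n ≫ e) (hc : Cof S (pushout.desc ℓ e w)) :
    Cof S (relativeLatchingMap g n) := by
  rw [cof_iff] at hc ⊢
  intro Z Y p hp hp'
  have := hc p hp hp'
  rw [hasLiftingProperty_pushoutDesc_iff] at this
  rw [hasLiftingProperty_relativeLatchingMap_iff]
  intro ℓ' a b h₁ h₂ h₃
  obtain ⟨t, ht₁, ht₂, ht₃⟩ := this (inv lat ≫ ℓ') a (inv c ≫ b)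
    (by rw [h₁, ← hk, Category.assoc, IsIso.hom_inv_id_assoc])
    (by rw [Category.assoc, ← h₂, ← cancel_epi lat, reassoc_of% hℓ]; simp)
    (by rw [← he, Category.assoc, IsIso.hom_inv_id_assoc, h₃])
  refine ⟨c ≫ t, ?_, ?_, ?_⟩
  · rw [← reassoc_of% hℓ, ht₁, IsIso.hom_inv_id_assoc]
  · rw [reassoc_of% he, ht₂]
  · rw [Category.assoc, ht₃, IsIso.hom_inv_id_assoc]

lemma rlp_cof_iff {X Y : M} (p : X ⟶ Y) : (Cof S).rlp p ↔ Fib S p ∧ W S p := by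
  rw [trivialFib_iff]
  exact ⟨fun h _ _ _ hi ↦ h _ hi, fun h _ _ _ hi ↦ h _ hi⟩

/-- The step in degree `n` of the Reedy factorization. -/
lemma exists_factorization_degree {E Y : CosimplicialObject M} (g : E ⟶ Y) (n : ℕ) :
    ∃ (Y' : CosimplicialObject M) (g' : E ⟶ Y') (p : Y' ⟶ Y), g' ≫ p = g ∧
      (∀ m, (Cof S).rlp (p.app m)) ∧
      (∀ m : SimplexCategory, m.len < n → IsIso (p.app m)) ∧
      Cof S (relativeLatchingMap g' n) := by
  let := S
  obtain ⟨X, j, q, hj, hq, hq', fac⟩ :=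
    exists_factorization_cof_trivialFib S (relativeLatchingMap g n)
  let ℓ := pushout.inl _ _ ≫ j
  let e := pushout.inr _ _ ≫ j
  have hℓ : ℓ ≫ q = latchingMap Y n := by
    rw [Category.assoc, fac, relativeLatchingMap, pushout.inl_desc]
  have he : e ≫ q = g.app ⦋n⦌ := by
    rw [Category.assoc, fac, relativeLatchingMap, pushout.inr_desc]
  have w : latchingObjMap g n ≫ ℓ = latchingMap E n ≫ e := by
    rw [← Category.assoc, ← Category.assoc, pushout.condition]
  obtain ⟨g', hg', hg''⟩ := exists_lift_attach g e he w.symm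
  have hiso (m : SimplexCategory) (hm : m.len < n) : IsIso ((attachFst q ℓ).app m) :=
    isIso_attachFst_app hℓ m hm
  have := isIso_latchingObjMap (attachFst q ℓ) n hiso
  have := isIso_attachπ_id hℓ
  refine ⟨attach q ℓ, g', attachFst q ℓ, hg', fun m U V i hi ↦ ?_, hiso, ?_⟩
  · have := (trivialFib_iff S q).mp ⟨hq, hq'⟩ i hi
    exact hasLiftingProperty_attachFst i hℓ m
  · refine cof_relativeLatchingMap_of_isIso S g' (latchingObjMap (attachFst q ℓ) n)
      (attachπ q ℓ (𝟙 _)) ℓ e (latchingObjMap g n) ?_ ?_ ?_ w ?_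
    · rw [← latchingObjMap_comp, hg']
    · refine latchingObj_hom_ext fun d i _ hd ↦ ?_
      rw [reassoc_of% latchingι_latchingObjMap (attachFst q ℓ) i hd,
        reassoc_of% latchingι_latchingMap (attach q ℓ) i hd, map_attachπ, Category.comp_id,
        ← attachFst_latchingη i (not_surjective_of_lt i hd), latchingη_of_mono]
    · rw [hg'']
      exact (congr_arg (· ≫ e) (E.map_id _)).trans (Category.id_comp _)
    · convert hj
      apply pushout.hom_ext
      · rw [pushout.inl_desc]
      · rw [pushout.inr_desc]

/-- Every map of cosimplicial objects is a Reedy cofibration followed by a levelwise trivial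
fibration: the factorization is the limit of a tower whose `n`-th step puts the required object
in degree `n` without changing the degrees `< n`. -/
theorem exists_reedy_factorization {E Y : CosimplicialObject M} (g : E ⟶ Y) :
    ∃ (D : CosimplicialObject M) (i : E ⟶ D) (p : D ⟶ Y), ReedyCofibration S i ∧
      (∀ m, Fib S (p.app m) ∧ W S (p.app m)) ∧ i ≫ p = g := by
  let := S
  choose next map p fac rlp iso cof using fun (s : Σ Y : CosimplicialObject M, (E ⟶ Y)) (n : ℕ) ↦
    exists_factorization_degree S s.2 n
  let stage (n : ℕ) : Σ Y : CosimplicialObject M, (E ⟶ Y) :=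
    Nat.rec ⟨Y, g⟩ (fun n s ↦ ⟨next s n, map s n⟩) n
  let X (n : ℕ) : SimplexCategory ⥤ M := (stage n).1
  let φ (n : ℕ) : X (n + 1) ⟶ X n := p (stage n) n
  let γ (n : ℕ) : (show SimplexCategory ⥤ M from E) ⟶ X n := (stage n).2
  have hγ (n : ℕ) : γ (n + 1) ≫ φ n = γ n := fac (stage n) n
  let F : ℕᵒᵖ ⥤ SimplexCategory ⥤ M := Functor.ofOpSequence φ
  -- In degree `m` the tower is constant from stage `m + 1` on, so that its limit exists.
  have hF (m : SimplexCategory) :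
      (F ⋙ (evaluation _ M).obj m).IsEventuallyConstantTo (.op (m.len + 1)) := by
    rintro ⟨j⟩ f
    exact ofOpSequence_map_mem
      ((MorphismProperty.isomorphisms M).inverseImage ((evaluation _ M).obj m))
      φ (fun n hn ↦ iso (stage n) n m hn) (leOfHom f.unop)
  have (m : SimplexCategory) : HasLimit (F.flip.obj m) := (hF m).hasLimit
  have : HasLimit F := inferInstance
  have hπ (m : SimplexCategory) (n : ℕ) (hn : m.len < n) :
      IsIso ((limit.π F (.op n)).app m) :=
    (hF m).isIso_π_of_isLimit' (isLimitOfPreserves ((evaluation _ M).obj m) (limit.isLimit F))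
      (.op n) (homOfLE hn).op
  let c : Cone F :=
    { pt := E
      π := NatTrans.ofOpSequence (F := (Functor.const _).obj _) γ fun n ↦ by
        refine (Category.id_comp _).trans ?_
        rw [Functor.ofOpSequence_map_homOfLE_succ φ n]
        exact (hγ n).symm }
  let i : (show SimplexCategory ⥤ M from E) ⟶ limit F := limit.lift F c
  have hi (n : ℕ) : i ≫ limit.π F (.op n) = γ n := limit.lift_π c _
  let D : CosimplicialObject M := (limit F : SimplexCategory ⥤ M)
  let i' : E ⟶ D := i
  refine ⟨D, i', limit.π F (.op 0), ?_, fun m ↦ ?_, hi 0⟩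
  · rw [reedyCofibration_iff]
    intro n
    let π : D ⟶ (stage (n + 1)).1 := limit.π F (.op (n + 1))
    have := isIso_latchingObjMap π n fun d hd ↦ hπ d (n + 1) (by lia)
    have : IsIso (π.app ⦋n⦌) := hπ ⦋n⦌ (n + 1) n.lt_succ_self
    refine cof_relativeLatchingMap_of_isIso S i' (latchingObjMap π n) (π.app ⦋n⦌)
      (latchingMap _ n) ((stage (n + 1)).2.app ⦋n⦌) (latchingObjMap (stage (n + 1)).2 n) ?_
      (latchingObjMap_latchingMap π n) ?_ (latchingObjMap_latchingMap _ _) (cof (stage n) n)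
    · exact (latchingObjMap_comp _ _ _).symm.trans (congr_arg (latchingObjMap · n) (hi (n + 1)))
    · exact NatTrans.congr_app (hi (n + 1)) ⦋n⦌
  · rw [← rlp_cof_iff]
    have h₁ : (Cof S).rlp ((limit.π F (.op (m.len + 1))).app m) := by
      have := hπ m _ m.len.lt_succ_self
      exact fun _ _ _ _ ↦ inferInstance
    have h₂ := ofOpSequence_map_mem (((Cof S).rlp).inverseImage ((evaluation _ M).obj m))
      φ (fun n _ ↦ rlp (stage n) n m) (Nat.zero_le (m.len + 1))
    have := (Cof S).rlp.comp_mem _ _ h₁ h₂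
    rwa [← NatTrans.congr_app (limit.w F (homOfLE (Nat.zero_le (m.len + 1))).op) m]

end ModelStructure

/-! ### Existence and independence of resolutions of maps -/

namespace ModelStructure

open Reedy

variable {M : Type u} [Category.{v} M] (S : ModelCategory M)

lemma reedyCofibrant_of_isInitial {O : CosimplicialObject M} (hO : IsInitial O) :
    ReedyCofibrant S O := by
  let := S
  rw [reedyCofibrant_iff]
  refine fun n Z Y p _ _ ↦ ⟨fun {_ _} sq ↦ ?_⟩
  have hO' := IsInitial.isInitialObj ((evaluation _ _).obj ⦋n⦌) _ hO
  exact ⟨⟨{ l := (simplexEquiv O n Z).symm (hO'.to Z)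
            fac_left := mappingComplex_initial_hom_ext hO _ _
            fac_right := mappingComplex_initial_hom_ext hO _ _ }⟩⟩

lemma exists_resolution_extending {E : CosimplicialObject M} (hE : ReedyCofibrant S E) {A : M}
    (g : E ⟶ (CosimplicialObject.const M).obj A) :
    ∃ (r : CosimplicialResolution S A) (i : E ⟶ r.obj), ReedyCofibration S i ∧
      (∀ m, Fib S (r.aug.app m)) ∧ i ≫ r.aug = g := by
  obtain ⟨D, i, p, hi, hp, fac⟩ := exists_reedy_factorization S g
  exact ⟨⟨D, p, hi.reedyCofibrant hE, fun n ↦ (hp n).2⟩, i, hi, fun m ↦ (hp m).1, fac⟩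

instance hasFiniteColimits_cosimplicialObject [HasFiniteColimits M] :
    HasFiniteColimits (CosimplicialObject M) :=
  inferInstanceAs (HasFiniteColimits (_ ⥤ _))

/-- Every map has a resolution which is a Reedy cofibration and whose augmentations are levelwise
trivial fibrations. -/
lemma exists_mapResolution {A B : M} (f : A ⟶ B) :
    ∃ r : MapResolution S f, ReedyCofibration S r.map ∧ (∀ m, Fib S (r.source.aug.app m)) ∧
      ∀ m, Fib S (r.target.aug.app m) := by
  let := S
  obtain ⟨a, -, -, ha, -⟩ := exists_resolution_extending S
    (reedyCofibrant_of_isInitial S (initialIsInitial (C := CosimplicialObject M)))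
    (initial.to ((CosimplicialObject.const M).obj A))
  obtain ⟨b, i, hi, hb, fac⟩ := exists_resolution_extending S a.reedyCofibrant
    (a.aug ≫ (CosimplicialObject.const M).map f)
  exact ⟨⟨a, b, i, fac⟩, hi, ha, hb⟩

lemma reedyCofibration_inl [HasFiniteColimits M] {A B : CosimplicialObject M}
    (hB : ReedyCofibrant S B) :
    ReedyCofibration S (pushout.inl (initial.to A) (initial.to B)) := by
  refine ReedyCofibration.of_isPushout (IsPushout.of_hasPushout _ _) ?_
  exact reedyCofibration_of_isInitial initialIsInitial hB

lemma reedyCofibration_inr [HasFiniteColimits M] {A B : CosimplicialObject M}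
    (hA : ReedyCofibrant S A) :
    ReedyCofibration S (pushout.inr (initial.to A) (initial.to B)) := by
  refine ReedyCofibration.of_isPushout (IsPushout.of_hasPushout _ _).flip ?_
  exact reedyCofibration_of_isInitial initialIsInitial hA

variable {S}

/-- A Reedy cofibration between resolutions of the same object. -/
lemma isWeakEquivalence_mappingComplexMap_of_resolution {A : M} {a a' : CosimplicialResolution S A}
    {i : a.obj ⟶ a'.obj} (hi : ReedyCofibration S i) (w : i ≫ a'.aug = a.aug) {X : M}
    (hX : Fibrant S X) : SimplicialSets.IsWeakEquivalence (mappingComplexMap i X) := by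
  refine hi.isWeakEquivalence (fun n ↦ ?_) hX
  refine (W S).of_postcomp _ _ (a'.weakEquivalence n) ?_
  have := a.weakEquivalence n
  rwa [← w] at this

/-- Two resolutions of a map embed into a third one, hence induce weakly equivalent maps of mapping
complexes. -/
theorem isWeakEquivalence_mappingComplexMap_iff {A B : M} {f : A ⟶ B} (r₁ r₂ : MapResolution S f)
    {X : M} (hX : Fibrant S X) :
    SimplicialSets.IsWeakEquivalence (mappingComplexMap r₁.map X) ↔
      SimplicialSets.IsWeakEquivalence (mappingComplexMap r₂.map X) := by
  let := S
  let E := pushout (initial.to r₁.source.obj) (initial.to r₂.source.obj)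
  let E' := pushout (initial.to r₁.target.obj) (initial.to r₂.target.obj)
  have hE : ReedyCofibrant S E :=
    (reedyCofibration_inl S r₂.source.reedyCofibrant).reedyCofibrant r₁.source.reedyCofibrant
  have hE' : ReedyCofibrant S E' :=
    (reedyCofibration_inl S r₂.target.reedyCofibrant).reedyCofibrant r₁.target.reedyCofibrant
  obtain ⟨a, i, hi, -, fac⟩ := exists_resolution_extending S hE
    (pushout.desc r₁.source.aug r₂.source.aug (initial.hom_ext _ _))
  let t : E ⟶ E' := pushout.desc (r₁.map ≫ pushout.inl _ _) (r₂.map ≫ pushout.inr _ _)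
    (initial.hom_ext _ _)
  have hP := ReedyCofibration.of_isPushout (IsPushout.of_hasPushout t i) hi
  obtain ⟨b, k, hk, -, fac'⟩ := exists_resolution_extending S (hP.reedyCofibrant hE')
    (pushout.desc (pushout.desc r₁.target.aug r₂.target.aug (initial.hom_ext _ _))
      (a.aug ≫ (CosimplicialObject.const M).map f) (by
        apply pushout.hom_ext
        · rw [reassoc_of% fac, pushout.inl_desc_assoc, pushout.inl_desc_assoc, Category.assoc,
            pushout.inl_desc, r₁.comm]
        · rw [reassoc_of% fac, pushout.inr_desc_assoc, pushout.inr_desc_assoc, Category.assoc,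
            pushout.inr_desc, r₂.comm]))
  have h₁ := isWeakEquivalence_mappingComplexMap_of_resolution (a := r₁.source) (a' := a)
    ((reedyCofibration_inl S r₂.source.reedyCofibrant).comp hi)
    (by rw [Category.assoc, fac, pushout.inl_desc]) hX
  have h₂ := isWeakEquivalence_mappingComplexMap_of_resolution (a := r₂.source) (a' := a)
    ((reedyCofibration_inr S r₁.source.reedyCofibrant).comp hi)
    (by rw [Category.assoc, fac, pushout.inr_desc]) hX
  have h₁' := isWeakEquivalence_mappingComplexMap_of_resolution (a := r₁.target) (a' := b)
    (((reedyCofibration_inl S r₂.target.reedyCofibrant).comp hP).comp hk)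
    (by rw [Category.assoc, Category.assoc, fac', pushout.inl_desc, pushout.inl_desc]) hX
  have h₂' := isWeakEquivalence_mappingComplexMap_of_resolution (a := r₂.target) (a' := b)
    (((reedyCofibration_inr S r₁.target.reedyCofibrant).comp hP).comp hk)
    (by rw [Category.assoc, Category.assoc, fac', pushout.inl_desc, pushout.inr_desc]) hX
  refine Iff.trans (SimplicialSets.IsWeakEquivalence.of_square
    (f := mappingComplexMap (pushout.inr t i ≫ k) X) (g := mappingComplexMap r₁.map X)
    ?_ h₁' h₁).symm (SimplicialSets.IsWeakEquivalence.of_square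
    (f := mappingComplexMap (pushout.inr t i ≫ k) X) (g := mappingComplexMap r₂.map X)
    ?_ h₂' h₂)
  · rw [← mappingComplexMap_comp, ← mappingComplexMap_comp]
    congr 1
    rw [Category.assoc, ← pushout.condition_assoc, pushout.inl_desc_assoc]
    simp only [Category.assoc]
  · rw [← mappingComplexMap_comp, ← mappingComplexMap_comp]
    congr 1
    rw [Category.assoc, ← pushout.condition_assoc, pushout.inr_desc_assoc]
    simp only [Category.assoc]

lemma mapIsWeakEquivalence_iff {A B : M} {f : A ⟶ B} (r : MapResolution S f) {X : M}
    (hX : Fibrant S X) :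
    MapIsWeakEquivalence S f X ↔ SimplicialSets.IsWeakEquivalence (mappingComplexMap r.map X) :=
  ⟨fun ⟨r', hr'⟩ ↦ (isWeakEquivalence_mappingComplexMap_iff r' r hX).mp hr', fun h ↦ ⟨r, h⟩⟩

/-- A resolution of the source of a weak equivalence is a resolution of its target. -/
lemma mapIsWeakEquivalence_of_weakEquivalence {A B : M} {f : A ⟶ B} (hf : W S f) (X : M) :
    MapIsWeakEquivalence S f X := by
  obtain ⟨r, -⟩ := exists_mapResolution S (𝟙 A)
  refine ⟨⟨r.source, ⟨r.source.obj, r.source.aug ≫ (CosimplicialObject.const M).map f,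
    r.source.reedyCofibrant, fun n ↦ (W S).comp_mem _ _ (r.source.weakEquivalence n) hf⟩, 𝟙 _,
    Category.id_comp _⟩, ?_⟩
  rw [mappingComplexMap_id]
  exact .of_isIso _

end ModelStructure

/-! ### Maps inducing weak equivalences of mapping complexes -/

namespace ModelStructure

section

variable {M : Type u} [Category.{v} M] [ModelCategory M]

/-- A fibration between bifibrant objects is a weak equivalence if it becomes invertible in the
homotopy category: an inverse is represented by a section, and the fibration is a retract of the
composition with this section, which is homotopic to the identity. -/
lemma weakEquivalence_of_isIso_map_of_fibration {X Y : M} (q : X ⟶ Y) [IsCofibrant X] [IsFibrant X]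
    [IsCofibrant Y] [IsFibrant Y] [Fibration q] [IsIso ((weakEquivalences M).Q.map q)] :
    WeakEquivalence q := by
  let L := (weakEquivalences M).Q
  obtain ⟨g, hg⟩ := map_surjective_of_isLocalization L Y X (inv (L.map q))
  have h₁ : LeftHomotopyRel (g ≫ q) (𝟙 Y) := by
    rw [LeftHomotopyRel.iff_map_eq L, Functor.map_comp, hg, IsIso.inv_hom_id,
      CategoryTheory.Functor.map_id]
  obtain ⟨P, _, ⟨h⟩⟩ := h₁.exists_good_cylinder
  obtain ⟨s, h', hs⟩ := h.covering_homotopy q g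
  have hs : s ≫ q = 𝟙 Y := by rw [← h'.h₁, Category.assoc, hs, h.h₁]
  have h₂ : LeftHomotopyRel (𝟙 X) (q ≫ s) := by
    rw [LeftHomotopyRel.iff_map_eq L, Functor.map_comp, CategoryTheory.Functor.map_id,
      ← cancel_mono (L.map q), Category.assoc, ← Functor.map_comp, hs]
    simp
  obtain ⟨P', ⟨h₂⟩⟩ := h₂
  have : WeakEquivalence (q ≫ s) := h₂.weakEquivalence_iff.mp inferInstance
  rw [weakEquivalence_iff] at this ⊢
  have r : RetractArrow q (q ≫ s) :=
    { i := Arrow.homMk (𝟙 X) s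
      r := Arrow.homMk (𝟙 X) q (by simp [hs])
      retract := by ext <;> simp [hs] }
  exact (weakEquivalences M).of_retract r this

/-- A map between fibrant objects is a weak equivalence if it becomes invertible in the homotopy
category: replace it by a map between bifibrant objects, and this map by a fibration. -/
lemma weakEquivalence_of_isIso_map {X Y : M} (f : X ⟶ Y) [IsFibrant X] [IsFibrant Y]
    [IsIso ((weakEquivalences M).Q.map f)] : WeakEquivalence f := by
  let L := (weakEquivalences M).Q
  have inverts {A B : M} (w : A ⟶ B) [hw : WeakEquivalence w] : IsIso (L.map w) :=
    Localization.inverts L (weakEquivalences M) w ((weakEquivalence_iff _).mp hw)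
  let d₁ := MorphismProperty.factorizationData (cofibrations M) (trivialFibrations M)
    (initial.to X)
  have : IsCofibrant d₁.Z := by
    rw [isCofibrant_iff, cofibration_iff, initial.hom_ext (initial.to d₁.Z) d₁.i]
    exact d₁.hi
  have := isFibrant_of_fibration d₁.p
  let d₂ := MorphismProperty.factorizationData (cofibrations M) (trivialFibrations M)
    (d₁.p ≫ f)
  have := isCofibrant_of_cofibration d₂.i
  have := isFibrant_of_fibration d₂.p
  let d₃ := MorphismProperty.factorizationData (trivialCofibrations M) (fibrations M) d₂.i
  have := isCofibrant_of_cofibration d₃.i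
  have := isFibrant_of_fibration d₃.p
  have := inverts d₁.p
  have := inverts d₂.p
  have := inverts d₃.i
  have : IsIso (L.map d₂.i) := by
    have : IsIso (L.map d₂.i ≫ L.map d₂.p) := by
      rw [← Functor.map_comp, d₂.fac, Functor.map_comp]
      infer_instance
    exact IsIso.of_isIso_comp_right _ (L.map d₂.p)
  have : IsIso (L.map d₃.p) := by
    have : IsIso (L.map d₃.i ≫ L.map d₃.p) := by
      rw [← Functor.map_comp, d₃.fac]
      infer_instance
    exact IsIso.of_isIso_comp_left (L.map d₃.i) _
  have := weakEquivalence_of_isIso_map_of_fibration d₃.p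
  have h : WeakEquivalence d₂.i := by
    rw [← d₃.fac]
    infer_instance
  have h : WeakEquivalence (d₁.p ≫ f) := by
    rw [← d₂.fac]
    infer_instance
  exact (weakEquivalence_precomp_iff d₁.p f).mp h

end

variable {M : Type u} [Category.{v} M] {S : ModelCategory M}

/-- Maps in the same component of a mapping complex agree in the homotopy category. -/
lemma map_eq_of_π₀_eq {A X : M} (a : CosimplicialResolution S A)
    {x y : (mappingComplex a.obj X) _⦋0⦌} (h : SSet.π₀.mk x = SSet.π₀.mk y) :
    (W S).Q.map (show a.obj.obj ⦋0⦌ ⟶ X from x) = (W S).Q.map (show a.obj.obj ⦋0⦌ ⟶ X from y) := by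
  let := S
  let L := (W S).Q
  have hL {A B : M} (w : A ⟶ B) (hw : W S w) : IsIso (L.map w) := Localization.inverts L (W S) w hw
  have hσ : IsIso (L.map (a.obj.map (SimplexCategory.σ (0 : Fin 1)))) := by
    refine hL _ ((W S).of_postcomp _ _ (a.weakEquivalence ⦋0⦌) ?_)
    have h : a.obj.map (SimplexCategory.σ (0 : Fin 1)) ≫ a.aug.app ⦋0⦌ = a.aug.app ⦋1⦌ :=
      (a.aug.naturality _).trans (Category.comp_id _)
    exact h ▸ a.weakEquivalence ⦋1⦌
  have hδ : L.map (a.obj.map (SimplexCategory.δ (0 : Fin 2))) =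
      L.map (a.obj.map (SimplexCategory.δ (1 : Fin 2))) := by
    rw [← cancel_mono (L.map (a.obj.map (SimplexCategory.σ (0 : Fin 1)))), ← Functor.map_comp,
      ← Functor.map_comp]
    refine congr_arg L.map ((a.obj.map_comp _ _).symm.trans (Eq.trans ?_ (a.obj.map_comp _ _)))
    exact congr_arg a.obj.map
      (SimplexCategory.δ_comp_σ_self.trans SimplexCategory.δ_comp_σ_succ.symm)
  refine congr_arg (SSet.π₀.lift (fun x : (mappingComplex a.obj X) _⦋0⦌ ↦
    L.map (show a.obj.obj ⦋0⦌ ⟶ X from x)) fun x₀ x₁ e ↦ ?_) h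
  let ε : a.obj.obj ⦋1⦌ ⟶ X := e.edge
  refine (congr_arg L.map (show x₀ = a.obj.map (SimplexCategory.δ (1 : Fin 2)) ≫ ε from
    e.src_eq.symm)).trans (Eq.trans ?_ (congr_arg L.map
      (show x₁ = a.obj.map (SimplexCategory.δ (0 : Fin 2)) ≫ ε from e.tgt_eq.symm)).symm)
  rw [L.map_comp, L.map_comp, hδ]

/-- If `X` and `Y` are fibrant, a map `X ⟶ Y` is a weak equivalence as soon as it induces bijections
on the components of the mapping complexes to `X` and to `Y`. -/
theorem weakEquivalence_of_mapIsWeakEquivalence {X Y : M} {f : X ⟶ Y} (hX : Fibrant S X)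
    (hY : Fibrant S Y) (h : MapIsWeakEquivalence S f X) (h' : MapIsWeakEquivalence S f Y) :
    W S f := by
  let := S
  obtain ⟨r, h⟩ := h
  rw [mapIsWeakEquivalence_iff r hY] at h'
  let L := (W S).Q
  let a : r.source.obj.obj ⦋0⦌ ⟶ X := r.source.aug.app ⦋0⦌
  let b : r.target.obj.obj ⦋0⦌ ⟶ Y := r.target.aug.app ⦋0⦌
  let g := r.map.app ⦋0⦌
  have comm : g ≫ b = a ≫ f := NatTrans.congr_app r.comm ⦋0⦌
  have : IsIso (L.map a) := Localization.inverts L (W S) _ (r.source.weakEquivalence ⦋0⦌)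
  have : IsIso (L.map b) := Localization.inverts L (W S) _ (r.target.weakEquivalence ⦋0⦌)
  obtain ⟨x, hx⟩ := h.bijective_mapπ₀.2 (SSet.π₀.mk (X := mappingComplex r.source.obj X) a)
  obtain ⟨ρ, rfl⟩ := SSet.π₀.mk_surjective x
  change r.target.obj.obj ⦋0⦌ ⟶ X at ρ
  -- `ρ` represents an inverse of `f`: surjectivity on components of the complexes to `X` gives one
  -- identity, injectivity on components of the complexes to `Y` the other one.
  have h₁ : L.map g ≫ L.map ρ = L.map a :=
    (L.map_comp _ _).symm.trans (map_eq_of_π₀_eq r.source hx)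
  have h₂ : L.map ρ ≫ L.map f = L.map b := by
    refine (L.map_comp _ _).symm.trans (map_eq_of_π₀_eq r.target (h'.bijective_mapπ₀.1 ?_))
    have h₃ : (g ≫ ρ) ≫ f = g ≫ ρ ≫ f := Category.assoc _ _ _
    exact (congr_arg (SSet.π₀.mk (X := mappingComplex r.source.obj Y)) h₃.symm).trans
      ((congr_arg (SSet.mapπ₀ (mappingComplexPost r.source.obj f)) hx).trans
        (congr_arg (SSet.π₀.mk (X := mappingComplex r.source.obj Y)) comm.symm))
  have : IsIso ((weakEquivalences M).Q.map f) := by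
    change IsIso (L.map f)
    refine ⟨inv (L.map b) ≫ L.map ρ, ?_, ?_⟩
    · rw [← cancel_epi (L.map a), ← Functor.map_comp_assoc, ← comm, Functor.map_comp,
        Category.assoc, IsIso.hom_inv_id_assoc, h₁, Category.comp_id]
    · rw [Category.assoc, h₂, IsIso.inv_hom_id]
  have : IsFibrant X := hX
  have : IsFibrant Y := hY
  exact (weakEquivalence_iff _).mp (weakEquivalence_of_isIso_map f)

end ModelStructure

/-! ### Left-induced model structures and mapping complexes -/

namespace ModelStructure

open Reedy

section

variable {M : Type u} [Category.{v} M]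

/-- A model structure is determined by its cofibrations and weak equivalences. -/
lemma modelCategory_ext {S S' : ModelCategory M} (hc : Cof S = Cof S') (hw : W S = W S') :
    S = S' := by
  have hf : Fib S = Fib S' := by
    ext X Y p
    rw [fib_iff, fib_iff, hc, hw]
  obtain @⟨⟨f⟩, ⟨c⟩, ⟨w⟩⟩ := S
  obtain @⟨⟨f'⟩, ⟨c'⟩, ⟨w'⟩⟩ := S'
  obtain rfl : f = f' := hf
  obtain rfl : c = c' := hc
  obtain rfl : w = w' := hw
  rfl

lemma ReedyCofibration.of_cof_eq {S S' : ModelCategory M} (hc : Cof S = Cof S')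
    {A B : CosimplicialObject M} {g : A ⟶ B} (hg : ReedyCofibration S g) :
    ReedyCofibration S' g := by
  let := S
  rw [reedyCofibration_iff] at hg ⊢
  exact fun n ↦ hc.le _ (hg n)

end

variable {M : Type u} [Category.{v} M] {N : Type u'} [Category.{v} N] {F : N ⥤ M} {G : M ⥤ N}

/-- The application of a functor in each degree of a cosimplicial object. -/
abbrev mapCosimplicial (F : N ⥤ M) : CosimplicialObject N ⥤ CosimplicialObject M :=
  (CosimplicialObject.whiskering N M).obj F

/-- For an adjunction `F ⊣ G`, the isomorphism `M(F A^•, X) ≅ M(A^•, G X)`. -/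
def mappingComplexAdjIso (adj : F ⊣ G) (A : CosimplicialObject N) (X : M) :
    mappingComplex ((mapCosimplicial F).obj A) X ≅ mappingComplex A (G.obj X) :=
  NatIso.ofComponents (fun n ↦ (adj.homEquiv (A.obj n.unop) X).toIso) fun {n m} α ↦ by
    ext x
    exact adj.homEquiv_naturality_left (A.map α.unop) x

lemma mappingComplexAdjIso_post (adj : F ⊣ G) (A : CosimplicialObject N) {X Y : M} (p : X ⟶ Y) :
    mappingComplexPost ((mapCosimplicial F).obj A) p ≫ (mappingComplexAdjIso adj A Y).hom =
      (mappingComplexAdjIso adj A X).hom ≫ mappingComplexPost A (G.map p) := by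
  ext n x
  exact adj.homEquiv_naturality_right x p

lemma mappingComplexAdjIso_map (adj : F ⊣ G) {A B : CosimplicialObject N} (g : A ⟶ B) (X : M) :
    mappingComplexMap ((mapCosimplicial F).map g) X ≫ (mappingComplexAdjIso adj A X).hom =
      (mappingComplexAdjIso adj B X).hom ≫ mappingComplexMap g (G.obj X) := by
  ext n x
  exact adj.homEquiv_naturality_left (g.app n.unop) x

variable {S : ModelCategory M} {T : ModelCategory N}

namespace IsLeftInduced

lemma weq_iff (hT : IsLeftInduced S F T) {A B : N} (f : A ⟶ B) : W T f ↔ W S (F.map f) := by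
  rw [hT.weakEquivalences_eq]
  rfl

lemma cof_iff (hT : IsLeftInduced S F T) {A B : N} (f : A ⟶ B) : Cof T f ↔ Cof S (F.map f) := by
  rw [hT.cofibrations_eq]
  rfl

lemma fibrant_obj (hT : IsLeftInduced S F T) (adj : F ⊣ G) {X : M} (hX : Fibrant S X) :
    Fibrant T (G.obj X) := by
  rw [fibrant_iff] at hX ⊢
  intro A B i hi hi' f
  obtain ⟨g, hg⟩ := hX (F.map i) ((hT.cof_iff i).mp hi) ((hT.weq_iff i).mp hi')
    ((adj.homEquiv A X).symm f)
  refine ⟨adj.homEquiv B X g, ?_⟩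
  rw [← adj.homEquiv_naturality_left, hg, Equiv.apply_symm_apply]

lemma trivialFib_map (hT : IsLeftInduced S F T) (adj : F ⊣ G) {X Y : M} {p : X ⟶ Y}
    (hp : Fib S p) (hp' : W S p) : Fib T (G.map p) ∧ W T (G.map p) := by
  rw [trivialFib_iff]
  intro A B i hi
  rw [← adj.hasLiftingProperty_iff]
  exact (trivialFib_iff S p).mp ⟨hp, hp'⟩ _ ((hT.cof_iff i).mp hi)

lemma reedyCofibrant (hT : IsLeftInduced S F T) (adj : F ⊣ G) {A : CosimplicialObject N}
    (hA : ReedyCofibrant T A) : ReedyCofibrant S ((mapCosimplicial F).obj A) := by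
  rw [reedyCofibrant_iff] at hA ⊢
  intro n Z Y p hp hp'
  have := hA n (G.map p) (hT.trivialFib_map adj hp hp').1 (hT.trivialFib_map adj hp hp').2
  let e : Arrow.mk (mappingComplexPost ((mapCosimplicial F).obj A) p) ≅
      Arrow.mk (mappingComplexPost A (G.map p)) :=
    Arrow.isoMk (mappingComplexAdjIso adj A Z) (mappingComplexAdjIso adj A Y)
      (mappingComplexAdjIso_post adj A p).symm
  exact (HasLiftingProperty.iff_of_arrow_iso_right _ e).mpr this

end IsLeftInduced

/-- The left adjoint of a left-induced model structure preserves cosimplicial resolutions. -/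
def CosimplicialResolution.map (hT : IsLeftInduced S F T) (adj : F ⊣ G) {A : N}
    (a : CosimplicialResolution T A) : CosimplicialResolution S (F.obj A) where
  obj := (mapCosimplicial F).obj a.obj
  aug :=
    { app := fun n ↦ F.map (a.aug.app n)
      naturality := fun n m α ↦ by
        refine (F.map_comp _ _).symm.trans ((congr_arg F.map (a.aug.naturality α)).trans ?_)
        refine (congr_arg F.map (Category.comp_id _)).trans (Category.comp_id _).symm }
  reedyCofibrant := hT.reedyCofibrant adj a.reedyCofibrant
  weakEquivalence n := (hT.weq_iff _).mp (a.weakEquivalence n)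

/-- The left adjoint of a left-induced model structure preserves resolutions of maps. -/
def MapResolution.mapFunctor (hT : IsLeftInduced S F T) (adj : F ⊣ G) {A B : N} {f : A ⟶ B}
    (r : MapResolution T f) : MapResolution S (F.map f) where
  source := r.source.map hT adj
  target := r.target.map hT adj
  map := (mapCosimplicial F).map r.map
  comm := by
    refine NatTrans.ext (funext fun n ↦ ?_)
    refine (F.map_comp _ _).symm.trans ((congr_arg F.map (NatTrans.congr_app r.comm n)).trans ?_)
    exact F.map_comp _ _

lemma IsLeftInduced.mapIsWeakEquivalence_iff (hT : IsLeftInduced S F T) (adj : F ⊣ G) {A B : N}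
    (f : A ⟶ B) {X : M} (hX : Fibrant S X) :
    MapIsWeakEquivalence T f (G.obj X) ↔ MapIsWeakEquivalence S (F.map f) X := by
  obtain ⟨r, -⟩ := exists_mapResolution T f
  rw [ModelStructure.mapIsWeakEquivalence_iff r (hT.fibrant_obj adj hX),
    ModelStructure.mapIsWeakEquivalence_iff (r.mapFunctor hT adj) hX]
  exact (SimplicialSets.IsWeakEquivalence.of_square (mappingComplexAdjIso_map adj r.map X)
    (.of_isIso _) (.of_isIso _)).symm

/-! ### Left-induced model structures and left Bousfield localizations -/

section

variable {C : MorphismProperty M} {K : Comonad M} {T : ModelCategory K.Coalgebra}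

/-- The class `C'` consists of the maps whose image under the forgetful functor is a `C`-local
equivalence, because `map(B, KX)` is `map(U B, X)`. -/
lemma coalgebraClass_eq (hT : IsLeftInduced S K.forget T) :
    coalgebraClass S C K T = (localEquivalences S C).inverseImage K.forget := by
  ext A B f
  exact forall_congr' fun X ↦ forall_congr' fun hX ↦
    hT.mapIsWeakEquivalence_iff K.adj f hX.1

lemma isLocalObject_cofree (hT : IsLeftInduced S K.forget T) {X : M} (hX : IsLocalObject S C X) :
    IsLocalObject T (coalgebraClass S C K T) (K.cofree.obj X) :=
  ⟨hT.fibrant_obj K.adj hX.1, fun _ _ _ hf ↦ hf X hX⟩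

/-- The class `C'` of maps of coalgebras is the class of all `C'`-local equivalences, because the
cofree coalgebras on `C`-local objects are `C'`-local. -/
lemma localEquivalences_coalgebraClass (hT : IsLeftInduced S K.forget T) :
    localEquivalences T (coalgebraClass S C K T) = coalgebraClass S C K T := by
  ext A B f
  exact ⟨fun hf X hX ↦ hf _ (isLocalObject_cofree hT hX), fun hf X hX ↦ hX.2 f hf⟩

end

/-- A model structure with the cofibrations of `T` and the `C`-local equivalences as weak
equivalences is the left Bousfield localization if all `C`-local equivalences are in `C`. -/
theorem isLeftBousfieldLocalization_of_eq {T I : ModelCategory N} {C : MorphismProperty N}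
    (hC : localEquivalences T C = C) (hc : Cof I = Cof T) (hw : W I = C) :
    IsLeftBousfieldLocalization T C I where
  cofibrations_eq := hc
  weakEquivalences_eq := hw.trans hC.symm
  fibrations_eq := by
    ext X Y p
    rw [fib_iff, hC, hc, hw]
    exact ⟨fun h A B i hi ↦ h i hi.1 hi.2, fun h A B i hi hi' ↦ h i ⟨hi, hi'⟩⟩
  fibrant_iff X := by
    have hTI : W T ≤ W I := by
      rw [hw, ← hC]
      exact fun A B f hf X _ ↦ mapIsWeakEquivalence_of_weakEquivalence hf X
    have local_of_fibrant {X : N} (hX : Fibrant I X) : IsLocalObject T C X := by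
      refine ⟨?_, fun A B f hf ↦ ?_⟩
      · rw [fibrant_iff] at hX ⊢
        exact fun A B i hi hi' ↦ hX i (hc.symm.le _ hi) (hTI _ hi')
      · -- A Reedy cofibrant resolution of `f` for `T` is a Reedy trivial cofibration for `I`.
        obtain ⟨r, hr, -⟩ := exists_mapResolution T f
        refine ⟨r, (hr.of_cof_eq hc.symm).isWeakEquivalence (fun n ↦ ?_) hX⟩
        refine (W I).of_postcomp _ _ (hTI _ (r.target.weakEquivalence n)) ?_
        have h : r.map.app n ≫ r.target.aug.app n = r.source.aug.app n ≫ f :=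
          NatTrans.congr_app r.comm n
        rw [h]
        exact (W I).comp_mem _ _ (hTI _ (r.source.weakEquivalence n)) (hw.symm.le _ hf)
    refine ⟨local_of_fibrant, fun hX ↦ ?_⟩
    -- Compare `X` with a fibrant replacement for `I`: both are local, so the comparison map is a
    -- weak equivalence for `T`, and `X` is a retract of the replacement.
    let := I
    obtain ⟨Y, i, p, hi, hi', hp, -⟩ := exists_factorization_trivialCof_fib I (terminal.from X)
    have hY : Fibrant I Y := by
      change IsFibrant Y
      rw [isFibrant_iff, HomotopicalAlgebra.fibration_iff, terminal.hom_ext (terminal.from Y) p]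
      exact hp
    have hY' := local_of_fibrant hY
    have hiC := hw.le _ hi'
    have hiT := weakEquivalence_of_mapIsWeakEquivalence hX.1 hY'.1 (hX.2 i hiC) (hY'.2 i hiC)
    obtain ⟨r, hr⟩ := (ModelStructure.fibrant_iff T X).mp hX.1 i (hc.le _ hi) hiT (𝟙 X)
    rw [ModelStructure.fibrant_iff] at hY ⊢
    intro A B j hj hj' f
    obtain ⟨g, hg⟩ := hY j hj hj' (f ≫ i)
    exact ⟨g ≫ r, by rw [reassoc_of% hg, hr, Category.comp_id]⟩

end ModelStructure

theorem mainTheorem1 {M : Type u} [Category.{v} M] (S : ModelCategory M)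
    (C : MorphismProperty M)
    (hC : ∀ ⦃A B : M⦄ (f : A ⟶ B), C f → Cof S f ∧ Cofibrant S A ∧ Cofibrant S B)
    (LCM : ModelCategory M) (hLCM : IsLeftBousfieldLocalization S C LCM)
    (K : Comonad M) (T : ModelCategory K.Coalgebra) (hT : IsLeftInduced S K.forget T) :
    ((∃ I : ModelCategory K.Coalgebra, IsLeftInduced LCM K.forget I) ↔
      (∃ L : ModelCategory K.Coalgebra,
        IsLeftBousfieldLocalization T (coalgebraClass S C K T) L)) ∧
    (∀ I L : ModelCategory K.Coalgebra, IsLeftInduced LCM K.forget I →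
      IsLeftBousfieldLocalization T (coalgebraClass S C K T) L → I = L) := by
  have hW : (W LCM).inverseImage K.forget = coalgebraClass S C K T := by
    rw [coalgebraClass_eq hT, hLCM.weakEquivalences_eq]
  have hCof : (Cof LCM).inverseImage K.forget = Cof T := by
    rw [hLCM.cofibrations_eq, hT.cofibrations_eq]
  have hloc := localEquivalences_coalgebraClass (C := C) hT
  refine ⟨⟨fun ⟨I, hI⟩ ↦ ⟨I, ?_⟩, fun ⟨L, hL⟩ ↦ ⟨L, ?_, ?_⟩⟩, fun I L hI hL ↦ ?_⟩
  · exact isLeftBousfieldLocalization_of_eq hloc (hI.cofibrations_eq.trans hCof)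
      (hI.weakEquivalences_eq.trans hW)
  · rw [hL.weakEquivalences_eq, hloc, hW]
  · rw [hL.cofibrations_eq, hCof]
  · refine modelCategory_ext ?_ ?_
    · rw [hI.cofibrations_eq, hL.cofibrations_eq, hCof]
    · rw [hI.weakEquivalences_eq, hL.weakEquivalences_eq, hloc, hW]
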